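/- Let $d\ge 1$ be an integer, $0<\alpha\le 2$, and let $p_t(x,y)=p_t(x-y)$, $t>0$, $x,y\in\mathbb R^d$, be the transition densities of the rotationally invariant $\alpha$-stable process in $\mathbb R^d$, so that $\int_{\mathbb R^d}e^{-iy\cdot\xi}p_t(y)\,dy=e^{-t|\xi|^\alpha}$. Let $\mathbb E^t_{x,y}$ be the expectation for the stable bridge $(X_s)_{0\le s\le t}$ from $x$ to $y$ of length $t$, i.e. the càdlàg process with $X_0=x$, $X_t=y$ such that, for $0=s_0<s_1<\dots<s_k<s_{k+1}=t$, $(X_{s_1},\dots,X_{s_k})$ has density $\frac1{p_t(x,y)}\prod_{j=0}^{k}p_{s_{j+1}-s_j}(z_j,z_{j+1})$ with $z_0=x$, $z_{k+1}=y$. Let $V:\mathbb R^d\to\mathbb R$ be a Schwartz function. The heat kernel of $(-\Delta)^{\alpha/2}+V$ is $p_t^{H_V}(x,y)=p_t(x,y)\,\mathbb E^t_{x,y}\big[e^{-\int_0^tV(X_s)\,ds}\big]$ and the heat content is $$Q_V^{(\alpha)}(t)=\int_{\mathbb R^d}\int_{\mathbb R^d}\big(p_t^{H_V}(x,y)-p_t(x,y)\big)\,dx\,dy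 .$$ Put $\widehat V(\xi)=\int_{\mathbb R^d}e^{-ix\cdot\xi}V(x)\,dx$, $I_k=\{(\lambda_k,\dots,\lambda_1):0<\lambda_k<\dots<\lambda_1<1\}$, and, for integers $n\ge0$, $k\ge2$, $$C_{n,k}(V)=\sum_{\substack{\ell_1,\dots,\ell_{k-1}\ge0\\ \ell_1+\dots+\ell_{k-1}=n}}A(n,\ell)\,(2\pi)^{-d(k-1)}\int_{\mathbb R^{(k-1)d}}\widehat V\Big(-\sum_{i=1}^{k-1}\theta_i\Big)\prod_{i=1}^{k-1}\Big(\widehat V(\theta_i)\,|\theta_1+\dots+\theta_i|^{\alpha\ell_i}\Big)\,d\theta_1\cdots d\theta_{k-1},$$ $$A(n,\ell)=\binom{n}{\ell_1,\dots,\ell_{k-1}}\int_{I_k}\prod_{i=1}^{k-1}(\lambda_i-\lambda_{i+1})^{\ell_i}\,d\lambda .$$ Finally let $C_\ell(V)=\sum_{n+k=\ell,\ n\ge 0,\ k\ge2}\frac1{n!}C_{n,k}(V)$ for $\ell\ge2$. Then the double integral defining $Q_V^{(\alpha)}(t)$ converges absolutely for every $t>0$, all the integrals over $\mathbb R^{(k-1)d}$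 in the definition of $C_{n,k}(V)$ converge absolutely, and for every integer $N\ge2$, $$Q_V^{(\alpha)}(t)=-t\int_{\mathbb R^d}V(\theta)\,d\theta+\sum_{\ell=2}^{N}(-t)^\ell C_\ell(V)+O(t^{N+1})\qquad\text{as }t\downarrow0 .$$ -/

import Mathlib

open MeasureTheory Filter Topology Asymptotics

noncomputable section

namespace HeatContent

/-- The Euclidean space `ℝ^d`. -/
abbrev E (d : ℕ) : Type := EuclideanSpace ℝ (Fin d)

variable {d : ℕ}

/-- The density `p_t^{(α)}` of the rotationally invariant `α`-stable process at time `t`, i.e.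
the function with Fourier transform `ξ ↦ exp (-t |ξ|^α)`, written by Fourier inversion
(the sine part vanishes by symmetry). -/
def stableDensity (α t : ℝ) (x : E d) : ℝ :=
  ((2 * Real.pi) ^ d)⁻¹ * ∫ ξ : E d, Real.cos (inner ℝ x ξ) * Real.exp (-t * ‖ξ‖ ^ α)

/-- The transition density `p_t^{(α)}(x, y) = p_t^{(α)}(x - y)`. -/
def stableKernel (α t : ℝ) (x y : E d) : ℝ := stableDensity α t (x - y)

/-- The finite-dimensional density of the stable bridge from `x` (time `0`) to `y` (time `t`) at
the times `s 0 < ⋯ < s (k-1)` in `(0, t)`: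
`p_t(x,y)⁻¹ ∏_{j=0}^{k} p_{s_{j+1} - s_j}(z_j, z_{j+1})`, where the lists of times and positions
are completed by `(0, x)` in front and by `(t, y)` at the end. -/
def bridgeDensity (α t : ℝ) (x y : E d) {k : ℕ} (s : Fin k → ℝ) (z : Fin k → E d) : ℝ :=
  let s' : Fin (k + 2) → ℝ :=
    Fin.cons (α := fun _ => ℝ) 0 (Fin.snoc (α := fun _ => ℝ) s t)
  let z' : Fin (k + 2) → E d :=
    Fin.cons (α := fun _ => E d) x (Fin.snoc (α := fun _ => E d) z y)
  (∏ j : Fin (k + 1),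
      stableKernel α (s' j.succ - s' j.castSucc) (z' j.castSucc) (z' j.succ)) /
    stableKernel α t x y

/-- Under `P`, the process `(X s)_{0 ≤ s ≤ t}` is the `α`-stable bridge from `x` to `y` of
length `t`: it has càdlàg paths, starts at `x`, ends at `y`, and has the finite-dimensional
distributions of the `α`-stable process started at `x` and conditioned to be at `y` at
time `t`. -/
structure IsStableBridge {Ω : Type*} [MeasurableSpace Ω] (α t : ℝ) (x y : E d)
    (X : ℝ → Ω → E d) (P : Measure Ω) : Prop where
  isProbabilityMeasure : IsProbabilityMeasure P
  measurable : ∀ s ∈ Set.Icc 0 t, Measurable (X s)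
  rightContinuous : ∀ᵐ ω ∂P, ∀ s ∈ Set.Ico 0 t,
    ContinuousWithinAt (fun u => X u ω) (Set.Ici s) s
  leftLimits : ∀ᵐ ω ∂P, ∀ s ∈ Set.Ioc 0 t, ∃ l : E d,
    Tendsto (fun u => X u ω) (𝓝[<] s) (𝓝 l)
  start : ∀ᵐ ω ∂P, X 0 ω = x
  finish : ∀ᵐ ω ∂P, X t ω = y
  finiteDimensional : ∀ (k : ℕ) (s : Fin k → ℝ), StrictMono s → (∀ i, s i ∈ Set.Ioo 0 t) →
    P.map (fun ω (i : Fin k) => X (s i) ω) =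
      (volume : Measure (Fin k → E d)).withDensity
        (fun z => ENNReal.ofReal (bridgeDensity α t x y s z))

/-- The heat kernel of `exp (-t H_V)`, `H_V = (-Δ)^{α/2} + V`, given by the Feynman-Kac formula
`p_t(x,y) E^t_{x,y}[exp (-∫_0^t V(X_s) ds)]`; `P t x y` is the law of the bridge. -/
def schrodingerKernel {Ω : Type*} [MeasurableSpace Ω] (α : ℝ) (V : E d → ℝ)
    (X : ℝ → Ω → E d) (P : ℝ → E d → E d → Measure Ω) (t : ℝ) (x y : E d) : ℝ :=
  stableKernel α t x y * ∫ ω, Real.exp (-∫ s in (0 : ℝ)..t, V (X s ω)) ∂(P t x y)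

/-- The heat content `Q_V^{(α)}(t) = ∫∫ (p_t^{H_V}(x,y) - p_t^{(α)}(x,y)) dx dy`. -/
def heatContent {Ω : Type*} [MeasurableSpace Ω] (α : ℝ) (V : E d → ℝ)
    (X : ℝ → Ω → E d) (P : ℝ → E d → E d → Measure Ω) (t : ℝ) : ℝ :=
  ∫ x : E d, ∫ y : E d, (schrodingerKernel α V X P t x y - stableKernel α t x y)

/-- The Fourier transform `∫ exp (-i x·ξ) V(x) dx`. -/
def fourierHat (V : E d → ℝ) (ξ : E d) : ℂ :=
  ∫ x : E d, Complex.exp (-(Complex.I * ((inner ℝ x ξ : ℝ) : ℂ))) * (V x : ℂ)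

/-- The simplex `I_k = {0 < λ_k < ⋯ < λ_1 < 1}`; the entry with index `i` is `λ_{i+1}`. -/
def timeSimplex (k : ℕ) : Set (Fin k → ℝ) :=
  {l | StrictAnti l ∧ ∀ i, l i ∈ Set.Ioo (0 : ℝ) 1}

/-- `A(n, ℓ)` for `ℓ ∈ ℕ^m`, `m = k - 1`, `n = ℓ_1 + ⋯ + ℓ_m`: the multinomial coefficient times
`∫_{I_k} ∏_{i=1}^{k-1} (λ_i - λ_{i+1})^{ℓ_i} dλ`. -/
def simplexWeight {m : ℕ} (ℓ : Fin m → ℕ) : ℝ :=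
  (Nat.multinomial Finset.univ ℓ : ℝ) *
    ∫ l in timeSimplex (m + 1), ∏ i : Fin m, (l i.castSucc - l i.succ) ^ ℓ i

/-- `V̂(-∑_i θ_i) ∏_i V̂(θ_i) |θ_1 + ⋯ + θ_i|^{α ℓ_i}`, for `θ_1, …, θ_m ∈ ℝ^d`. -/
def fourierIntegrand (α : ℝ) (V : E d → ℝ) {m : ℕ} (ℓ : Fin m → ℕ) (θ : Fin m → E d) : ℂ :=
  fourierHat V (-∑ i, θ i) *
    ∏ i : Fin m, (fourierHat V (θ i) *
      ((‖∑ j ∈ Finset.Iic i, θ j‖ ^ (α * (ℓ i : ℝ)) : ℝ) : ℂ))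

/-- The coefficient `C_{n,k}(V)`, for `k ≥ 2`; the integral is with respect to
`(2π)^{-d(k-1)} dθ`. -/
def coeffNK (α : ℝ) (V : E d → ℝ) (n k : ℕ) : ℂ :=
  ∑ ℓ ∈ Finset.piAntidiag (Finset.univ : Finset (Fin (k - 1))) n,
    (simplexWeight ℓ : ℂ) *
      ((((2 * Real.pi) ^ (d * (k - 1)))⁻¹ : ℝ) : ℂ) *
        ∫ θ : Fin (k - 1) → E d, fourierIntegrand α V ℓ θ

/-- The coefficient `C_ℓ(V) = ∑_{n+k=ℓ, k≥2} C_{n,k}(V) / n!`. -/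
def coeff (α : ℝ) (V : E d → ℝ) (ℓ : ℕ) : ℂ :=
  ∑ p ∈ (Finset.HasAntidiagonal.antidiagonal ℓ).filter (fun p => 2 ≤ p.2),
    (1 / (Nat.factorial p.1 : ℂ)) * coeffNK α V p.1 p.2

end HeatContent

end

/-!
The bridge expectations are expanded in moments of `∫_0^t V(X_s) ds`, and every moment is turned
into a Fourier integral whose dependence on `t` is explicit.

*The stable density.* Positivity of `p_t` comes from the bridges: the one-point law of a bridge
from `x` to `y` is a probability measure, which forces `p_t(x,y) ≠ 0`; since `p_t` is continuous
and `p_t(0) > 0`, it is positive on the connected space `ℝ^d` (`stableDensity_pos_of_ne_zero`). A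
nonnegative function whose Fourier transform is integrable and continuous at the origin is
integrable, with integral the value there, so `∫ p_t = 1`
(`stableDensity_integrable_and_integral`).

*Moments.* The `k`-th power of `∫_0^1 V(X_{ts}) ds` is `k!` times an integral over the simplex
`I_k` (`pow_integral_eq_factorial_mul_integral_timeSimplex`). Right continuity gives joint
measurability in time and path, and the finite-dimensional laws turn `p_t(x,y)` times the moment
into an integral of `∏ V(z_i)` against a product of `k + 1` transition densities. Bounding all but
one factor `V` by its supremum and using the one-point law shows absolute integrability in
`(x, y)`; integrating out the end points removes the two outer densities
(`integrable_weightedMoment`). The same bound with `|V|` controls the remainder of the exponential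
series after `N` terms by a constant times `t^{N+1}`
(`abs_integral_kernelDifference_sub_sum_le`).

*Fourier representation.* Writing each inner density `p_a(z_i - z_{i+1})` as a Fourier integral,
exchanging integrals and substituting `θ_i = ξ_i - ξ_{i-1}` gives
`(2π)^{-d(k-1)} ∫ V̂(-∑ θ_i) ∏ V̂(θ_i) exp (-t u) dθ`, where
`u = ∑ (λ_i - λ_{i+1}) |θ_1 + ⋯ + θ_i|^α ≥ 0` (`integral_chain_eq_fourier`).

*Expansion.* Taylor's formula for `exp (-t u)` with a remainder polynomial in `u`, the multinomial
theorem for `u^n` (`coeffNK_eq`) and the rapid decay of `V̂` give the coefficients `C_{n,k}`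
(`exists_expansion_bound`); collecting powers of `t` gives the `C_ℓ`.
-/

noncomputable section

namespace HeatContent

variable {d : ℕ}

/-! ### The stable density -/

lemma integrable_exp_neg_norm_rpow (hd : 1 ≤ d) {α t : ℝ} (hα : 0 < α) (ht : 0 < t) :
    Integrable (fun ξ : E d => Real.exp (-t * ‖ξ‖ ^ α)) := by
  have : Nonempty (Fin d) := ⟨⟨0, hd⟩⟩
  have h := (integrable_fun_norm_addHaar (volume : Measure (E d))
    (f := fun r : ℝ => Real.exp (-t * r ^ α))).2
  refine h ?_
  have h1 := integrableOn_rpow_mul_exp_neg_mul_rpow (p := α)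
    (s := ((Module.finrank ℝ (E d) - 1 : ℕ) : ℝ))
    (b := t) (by have : (0 : ℝ) ≤ ((Module.finrank ℝ (E d) - 1 : ℕ) : ℝ) := Nat.cast_nonneg _
                 linarith) hα ht
  refine h1.congr_fun (fun r _ => ?_) measurableSet_Ioi
  simp [Real.rpow_natCast]

lemma continuous_norm_rpow {α : ℝ} (hα : 0 ≤ α) : Continuous (fun ξ : E d => ‖ξ‖ ^ α) :=
  continuous_norm.rpow_const (fun _ => Or.inr hα)

lemma continuous_stableDensity (hd : 1 ≤ d) {α t : ℝ} (hα : 0 < α) (ht : 0 < t) :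
    Continuous (stableDensity (d := d) α t) := by
  unfold stableDensity
  refine continuous_const.mul ?_
  have hc := continuous_norm_rpow (d := d) hα.le
  refine continuous_of_dominated (bound := fun ξ => Real.exp (-t * ‖ξ‖ ^ α))
    (fun x => Continuous.aestronglyMeasurable (by fun_prop)) (fun x => ae_of_all _ fun ξ => ?_)
    (integrable_exp_neg_norm_rpow hd hα ht) (ae_of_all _ fun ξ => by fun_prop)
  rw [norm_mul, Real.norm_eq_abs, Real.norm_eq_abs, Real.abs_exp]
  exact mul_le_of_le_one_left (Real.exp_pos _).le (Real.abs_cos_le_one _)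

lemma measurable_stableDensity {α : ℝ} :
    Measurable (fun p : ℝ × E d => stableDensity α p.1 p.2) := by
  unfold stableDensity
  refine Measurable.const_mul ?_ _
  have : StronglyMeasurable (fun q : (ℝ × E d) × E d =>
      Real.cos (inner ℝ q.1.2 q.2) * Real.exp (-q.1.1 * ‖q.2‖ ^ α)) := by
    apply Measurable.stronglyMeasurable
    refine Measurable.mul ?_ ?_
    · exact (Continuous.measurable (by fun_prop))
    · exact Real.measurable_exp.comp
        ((measurable_fst.fst.neg).mul (measurable_snd.norm.pow_const α))
  exact this.integral_prod_right.measurable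

lemma measurable_stableKernel {β : Type*} [MeasurableSpace β] {α : ℝ} {τ : β → ℝ} {f g : β → E d}
    (hτ : Measurable τ) (hf : Measurable f) (hg : Measurable g) :
    Measurable (fun b => stableKernel α (τ b) (f b) (g b)) :=
  (measurable_stableDensity (d := d) (α := α)).comp (f := fun b => (τ b, f b - g b))
    (hτ.prodMk (hf.sub hg))

lemma stableDensity_neg (α t : ℝ) (x : E d) : stableDensity α t (-x) = stableDensity α t x := by
  simp [stableDensity, inner_neg_left]

lemma stableKernel_comm (α t : ℝ) (x y : E d) : stableKernel α t x y = stableKernel α t y x := by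
  rw [stableKernel, ← stableDensity_neg, neg_sub, stableKernel]

lemma abs_stableDensity_le (hd : 1 ≤ d) {α t : ℝ} (hα : 0 < α) (ht : 0 < t) (x : E d) :
    |stableDensity α t x| ≤ stableDensity (d := d) α t 0 := by
  have hp : (0 : ℝ) ≤ ((2 * Real.pi) ^ d)⁻¹ := by positivity
  unfold stableDensity
  rw [abs_mul, abs_of_nonneg hp]
  refine mul_le_mul_of_nonneg_left ?_ hp
  rw [← Real.norm_eq_abs]
  refine (norm_integral_le_integral_norm _).trans ?_
  refine integral_mono_of_nonneg (ae_of_all _ fun ξ => norm_nonneg _) ?_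
    (ae_of_all _ fun ξ => ?_)
  · simpa using integrable_exp_neg_norm_rpow hd hα ht
  · simp only [inner_zero_left, Real.cos_zero, one_mul]
    rw [norm_mul, Real.norm_eq_abs, Real.norm_eq_abs, Real.abs_exp]
    exact mul_le_of_le_one_left (Real.exp_pos _).le (Real.abs_cos_le_one _)

lemma stableDensity_zero_pos (hd : 1 ≤ d) {α t : ℝ} (hα : 0 < α) (ht : 0 < t) :
    0 < stableDensity (d := d) α t 0 := by
  unfold stableDensity
  refine mul_pos (by positivity) ?_
  simp only [inner_zero_left, Real.cos_zero, one_mul]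
  exact integral_exp_pos (integrable_exp_neg_norm_rpow hd hα ht)

/-- The sine part of the Fourier inversion integral vanishes because the symbol is even. -/
lemma stableDensity_eq_integral_cexp (hd : 1 ≤ d) {α t : ℝ} (hα : 0 < α) (ht : 0 < t) (x : E d) :
    (stableDensity α t x : ℂ) = (((2 * Real.pi) ^ d)⁻¹ : ℝ) *
      ∫ ξ : E d, Complex.exp (-(Complex.I * ((inner ℝ x ξ : ℝ) : ℂ))) *
        (Real.exp (-t * ‖ξ‖ ^ α) : ℂ) := by
  have hc := continuous_norm_rpow (d := d) hα.le
  have hint := integrable_exp_neg_norm_rpow hd hα ht (d := d)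
  have hcos : Integrable (fun ξ : E d => Real.cos (inner ℝ x ξ) * Real.exp (-t * ‖ξ‖ ^ α)) := by
    refine hint.mono' (Continuous.aestronglyMeasurable (by fun_prop)) (ae_of_all _ fun ξ => ?_)
    rw [norm_mul, Real.norm_eq_abs, Real.norm_eq_abs, Real.abs_exp]
    exact mul_le_of_le_one_left (Real.exp_pos _).le (Real.abs_cos_le_one _)
  have hsin : Integrable (fun ξ : E d => Real.sin (inner ℝ x ξ) * Real.exp (-t * ‖ξ‖ ^ α)) := by
    refine hint.mono' (Continuous.aestronglyMeasurable (by fun_prop)) (ae_of_all _ fun ξ => ?_)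
    rw [norm_mul, Real.norm_eq_abs, Real.norm_eq_abs, Real.abs_exp]
    exact mul_le_of_le_one_left (Real.exp_pos _).le (Real.abs_sin_le_one _)
  have hodd : ∫ ξ : E d, Real.sin (inner ℝ x ξ) * Real.exp (-t * ‖ξ‖ ^ α) = 0 := by
    have h := integral_neg_eq_self
      (fun ξ : E d => Real.sin (inner ℝ x ξ) * Real.exp (-t * ‖ξ‖ ^ α)) volume
    simp only [inner_neg_right, Real.sin_neg, norm_neg, neg_mul] at h
    rw [integral_neg] at h
    simp only [neg_mul]
    linarith
  have hsplit : (fun ξ : E d => Complex.exp (-(Complex.I * ((inner ℝ x ξ : ℝ) : ℂ))) *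
        (Real.exp (-t * ‖ξ‖ ^ α) : ℂ)) = fun ξ =>
      ((Real.cos (inner ℝ x ξ) * Real.exp (-t * ‖ξ‖ ^ α) : ℝ) : ℂ) -
        ((Real.sin (inner ℝ x ξ) * Real.exp (-t * ‖ξ‖ ^ α) : ℝ) : ℂ) * Complex.I := by
    funext ξ
    have : -(Complex.I * ((inner ℝ x ξ : ℝ) : ℂ)) = ((-(inner ℝ x ξ) : ℝ) : ℂ) * Complex.I := by
      push_cast; ring
    rw [this, Complex.exp_mul_I, ← Complex.ofReal_cos, ← Complex.ofReal_sin, Real.cos_neg,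
      Real.sin_neg]
    push_cast; ring
  rw [hsplit, integral_sub hcos.ofReal (hsin.ofReal.mul_const _), integral_mul_const,
    integral_complex_ofReal, integral_complex_ofReal, hodd]
  simp [stableDensity]

/-- The value at the origin is positive and a continuous function without zeros on the
connected space `ℝ^d` keeps its sign. -/
lemma stableDensity_pos_of_ne_zero (hd : 1 ≤ d) {α t : ℝ} (hα : 0 < α) (ht : 0 < t)
    (h : ∀ x : E d, stableDensity α t x ≠ 0) (x : E d) : 0 < stableDensity α t x := by
  by_contra hx
  obtain ⟨z, hz⟩ := mem_range_of_exists_le_of_exists_ge (continuous_stableDensity hd hα ht)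
    ⟨x, not_lt.1 hx⟩ ⟨0, (stableDensity_zero_pos hd hα ht).le⟩
  exact h z hz

open FourierTransform in
lemma fourier_exp_neg_norm_rpow (hd : 1 ≤ d) {α t : ℝ} (hα : 0 < α) (ht : 0 < t) (w : E d) :
    𝓕 (fun ξ : E d => (Real.exp (-t * ‖ξ‖ ^ α) : ℂ)) w =
      (((2 * Real.pi) ^ d * stableDensity α t ((2 * Real.pi) • w) : ℝ) : ℂ) := by
  have hne : (((2 * Real.pi) ^ d : ℝ) : ℂ) ≠ 0 := by
    have : (0 : ℝ) < (2 * Real.pi) ^ d := by positivity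
    exact_mod_cast this.ne'
  rw [Complex.ofReal_mul, stableDensity_eq_integral_cexp hd hα ht, ← mul_assoc,
    Complex.ofReal_inv, mul_inv_cancel₀ hne, one_mul, Real.fourier_eq']
  congr 1
  funext ξ
  rw [smul_eq_mul, inner_smul_left, real_inner_comm]
  congr 2
  simp
  ring

open FourierTransform in
/-- A nonnegative stable density has total mass `exp (-t |0|^α) = 1`: test the density against
Gaussians that increase to one, and use that its Fourier transform is continuous at the
origin. -/
lemma stableDensity_integrable_and_integral (hd : 1 ≤ d) {α t : ℝ} (hα : 0 < α) (ht : 0 < t)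
    (hpos : ∀ x : E d, 0 ≤ stableDensity α t x) :
    Integrable (stableDensity (d := d) α t) ∧ ∫ x : E d, stableDensity α t x = 1 := by
  have hc := continuous_norm_rpow (d := d) hα.le
  set g : E d → ℂ := fun ξ => (Real.exp (-t * ‖ξ‖ ^ α) : ℂ) with hg
  have hgint : Integrable g := (integrable_exp_neg_norm_rpow hd hα ht).ofReal
  have hgc : Continuous g := by fun_prop
  -- `q` is the density in the normalisation of `𝓕`, whose characters are `exp (-2πi x·ξ)`
  set q : E d → ℝ := fun w => (2 * Real.pi) ^ d * stableDensity α t ((2 * Real.pi) • w) with hq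
  have hqF : 𝓕 g = fun w => (q w : ℂ) := funext fun w => fourier_exp_neg_norm_rpow hd hα ht w
  have hq0 : ∀ w, 0 ≤ q w := fun w => mul_nonneg (by positivity) (hpos _)
  have hqc : Continuous q := by
    have := continuous_stableDensity (d := d) hd hα ht
    fun_prop
  have hlim : Tendsto (fun c : ℝ => ∫ w : E d, Complex.exp (-(c⁻¹ : ℂ) * ‖w‖ ^ 2) • (q w : ℂ))
      atTop (𝓝 1) := by
    have h1 := Real.tendsto_integral_gaussian_smul' hgint (v := 0) hgc.continuousAt
    have hg0 : g 0 = 1 := by simp [hg, Real.zero_rpow hα.ne']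
    rw [hg0] at h1
    refine h1.congr' ?_
    filter_upwards [Ioi_mem_atTop 0] with c (hc : 0 < c)
    have J : Integrable (fun w : E d => Complex.exp (- (c⁻¹ : ℂ) * ‖w‖ ^ 2 +
        2 * Real.pi * Complex.I * ((inner ℝ (0 : E d) w : ℝ) : ℂ))) :=
      GaussianFourier.integrable_cexp_neg_mul_sq_norm_add (by simpa) _ _
    have h2 := VectorFourier.integral_fourierIntegral_smul_eq_flip (L := innerₗ (E d))
      Real.continuous_fourierChar continuous_inner J hgint
    have h3 : ∫ w : E d, 𝓕 (fun w : E d => Complex.exp (- (c⁻¹ : ℂ) * ‖w‖ ^ 2 +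
        2 * Real.pi * Complex.I * ((inner ℝ (0 : E d) w : ℝ) : ℂ))) w • g w =
        ∫ w : E d, Complex.exp (-(c⁻¹ : ℂ) * ‖w‖ ^ 2) • (𝓕 g) w := by
      simpa using! h2
    rw [hqF] at h3
    rw [← h3]
    congr with w
    rw [fourier_gaussian_innerProductSpace' (by simpa)]
    congr 2
    · simp
    · congr 1
      simp
      ring
  have hgauss : ∀ c : ℝ, 0 < c → Integrable (fun w : E d => Real.exp (-c⁻¹ * ‖w‖ ^ 2) * q w) := by
    intro c hc
    have h1 : Integrable (fun w : E d => Real.exp (-c⁻¹ * ‖w‖ ^ 2)) := by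
      have := (GaussianFourier.integrable_cexp_neg_mul_sq_norm_add (V := E d) (b := (c⁻¹ : ℂ))
        (by simpa using hc) 0 0).re
      refine this.congr (ae_of_all _ fun w => ?_)
      simp only [inner_zero_left]
      have : (-(c⁻¹ : ℂ) * ‖w‖ ^ 2 + 0 * ((0 : ℝ) : ℂ)) = ((-c⁻¹ * ‖w‖ ^ 2 : ℝ) : ℂ) := by
        push_cast; ring
      rw [this, ← Complex.ofReal_exp]
      exact Complex.ofReal_re _
    refine h1.mul_bdd (c := (2 * Real.pi) ^ d * stableDensity (d := d) α t 0)
      hqc.aestronglyMeasurable (ae_of_all _ fun w => ?_)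
    rw [Real.norm_eq_abs, abs_of_nonneg (hq0 w)]
    exact mul_le_mul_of_nonneg_left ((le_abs_self _).trans (abs_stableDensity_le hd hα ht _))
      (by positivity)
  have hlimR : Tendsto (fun c : ℝ => ∫ w : E d, Real.exp (-c⁻¹ * ‖w‖ ^ 2) * q w)
      atTop (𝓝 1) := by
    have := (Complex.continuous_re.tendsto _).comp hlim
    simp only [Complex.one_re] at this
    refine this.congr fun c => ?_
    have h : (fun w : E d => Complex.exp (-(c⁻¹ : ℂ) * ‖w‖ ^ 2) • (q w : ℂ)) =
        fun w => ((Real.exp (-c⁻¹ * ‖w‖ ^ 2) * q w : ℝ) : ℂ) := by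
      funext w; simp
    simp only [Function.comp]
    rw [h, integral_complex_ofReal, Complex.ofReal_re]
  have hlimN : Tendsto (fun n : ℕ => ∫ w : E d, Real.exp (-((n : ℝ) + 1)⁻¹ * ‖w‖ ^ 2) * q w)
      atTop (𝓝 1) :=
    hlimR.comp (tendsto_atTop_add_const_right _ 1 tendsto_natCast_atTop_atTop)
  -- integrability of `q` by Fatou's lemma, the Gaussian integrals having the limit one
  have hqint : Integrable q := by
    refine ⟨hqc.aestronglyMeasurable, ?_⟩
    rw [hasFiniteIntegral_iff_ofReal (ae_of_all _ hq0)]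
    have hpt : ∀ w : E d, liminf (fun n : ℕ =>
        ENNReal.ofReal (Real.exp (-((n : ℝ) + 1)⁻¹ * ‖w‖ ^ 2) * q w)) atTop =
        ENNReal.ofReal (q w) := by
      intro w
      refine Tendsto.liminf_eq ?_
      refine ENNReal.tendsto_ofReal ?_
      have : Tendsto (fun n : ℕ => Real.exp (-((n : ℝ) + 1)⁻¹ * ‖w‖ ^ 2) * q w) atTop
          (𝓝 (Real.exp (-0 * ‖w‖ ^ 2) * q w)) := by
        have h0 : Tendsto (fun n : ℕ => ((n : ℝ) + 1)⁻¹) atTop (𝓝 0) :=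
          (tendsto_atTop_add_const_right _ 1 tendsto_natCast_atTop_atTop).inv_tendsto_atTop
        exact ((Real.continuous_exp.tendsto _).comp ((h0.neg).mul_const _)).mul_const _
      simpa using this
    have hF := lintegral_liminf_le (u := atTop) (μ := (volume : Measure (E d)))
      (f := fun (n : ℕ) w =>
        ENNReal.ofReal (Real.exp (-((n : ℝ) + 1)⁻¹ * ‖w‖ ^ 2) * q w))
        (fun n => ENNReal.measurable_ofReal.comp
          (Continuous.measurable (by fun_prop)))
    simp only [hpt] at hF
    have hT : Tendsto (fun n : ℕ => ∫⁻ w : E d,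
        ENNReal.ofReal (Real.exp (-((n : ℝ) + 1)⁻¹ * ‖w‖ ^ 2) * q w)) atTop
        (𝓝 (ENNReal.ofReal 1)) := by
      refine (ENNReal.tendsto_ofReal hlimN).congr fun n => ?_
      rw [ofReal_integral_eq_lintegral_ofReal (hgauss _ (by positivity))]
      exact ae_of_all _ fun w => mul_nonneg (Real.exp_pos _).le (hq0 w)
    rw [hT.liminf_eq] at hF
    exact hF.trans_lt ENNReal.ofReal_lt_top
  have hq1 : ∫ w, q w = 1 := by
    have h := Real.tendsto_integral_cexp_sq_smul (f := fun w => (q w : ℂ)) hqint.ofReal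
    simp only [Complex.ofReal_inv] at h
    have h' := tendsto_nhds_unique h hlim
    rw [integral_complex_ofReal] at h'
    exact_mod_cast h'
  have h2pi : (2 * Real.pi) ≠ 0 := by positivity
  have hpint : Integrable (stableDensity (d := d) α t) := by
    have h1 : Integrable (fun w : E d => stableDensity α t ((2 * Real.pi) • w)) := by
      have h2 := hqint.const_mul ((2 * Real.pi) ^ d)⁻¹
      refine h2.congr (ae_of_all _ fun w => ?_)
      simp only [hq]
      rw [inv_mul_cancel_left₀ (by positivity)]
    exact (integrable_comp_smul_iff volume _ h2pi).1 h1
  refine ⟨hpint, ?_⟩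
  have h1 := Measure.integral_comp_smul (volume : Measure (E d)) (stableDensity (d := d) α t)
    (2 * Real.pi)
  simp only [hq, integral_const_mul] at hq1
  rw [h1, finrank_euclideanSpace, Fintype.card_fin, abs_of_nonneg (by positivity), smul_eq_mul,
    mul_inv_cancel_left₀ (by positivity)] at hq1
  exact hq1

/-! ### The ordered simplex -/

lemma measurableSet_timeSimplex (k : ℕ) : MeasurableSet (timeSimplex k) := by
  have : timeSimplex k = (⋂ (i : Fin k) (j : Fin k) (_ : i < j), {l : Fin k → ℝ | l j < l i}) ∩
      ⋂ i : Fin k, {l : Fin k → ℝ | l i ∈ Set.Ioo (0 : ℝ) 1} := by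
    ext l
    simp only [timeSimplex, StrictAnti, Set.mem_ofPred_eq, Set.mem_inter_iff, Set.mem_iInter]
  rw [this]
  refine MeasurableSet.inter ?_ ?_
  · refine MeasurableSet.iInter fun i => MeasurableSet.iInter fun j => MeasurableSet.iInter fun _ =>
      measurableSet_lt (measurable_pi_apply j) (measurable_pi_apply i)
  · exact MeasurableSet.iInter fun i => measurable_pi_apply i measurableSet_Ioo

lemma timeSimplex_subset_pi (k : ℕ) :
    timeSimplex k ⊆ Set.pi Set.univ (fun _ : Fin k => Set.Ioo (0 : ℝ) 1) :=
  fun _ hl i _ => hl.2 i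

lemma volume_timeSimplex_le_one (k : ℕ) : volume (timeSimplex k) ≤ 1 := by
  refine (measure_mono (timeSimplex_subset_pi k)).trans ?_
  rw [Real.volume_pi_Ioo]
  simp

instance isFiniteMeasure_restrict_timeSimplex (k : ℕ) :
    IsFiniteMeasure ((volume : Measure (Fin k → ℝ)).restrict (timeSimplex k)) :=
  ⟨by rw [Measure.restrict_apply_univ]
      exact (volume_timeSimplex_le_one k).trans_lt ENNReal.one_lt_top⟩

lemma ae_injective (k : ℕ) : ∀ᵐ l : Fin k → ℝ, Function.Injective l := by
  have h : ∀ i j : Fin k, i ≠ j → ∀ᵐ l : Fin k → ℝ, l i ≠ l j := by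
    intro i j hij
    -- the coordinates `i` and `j` agree on a proper subspace, which is a null set
    set p : Submodule ℝ (Fin k → ℝ) :=
      LinearMap.ker (LinearMap.proj (R := ℝ) (φ := fun _ : Fin k => ℝ) i -
        LinearMap.proj (R := ℝ) (φ := fun _ : Fin k => ℝ) j) with hp
    have hne : p ≠ ⊤ := by
      intro h
      have hm : (Pi.single i (1 : ℝ)) ∈ p := by rw [h]; trivial
      rw [hp, LinearMap.mem_ker] at hm
      simp [hij.symm] at hm
    have h0 := Measure.addHaar_submodule (volume : Measure (Fin k → ℝ)) p hne
    rw [ae_iff]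
    refine measure_mono_null (fun l hl => ?_) h0
    simp only [ne_eq, not_not, Set.mem_ofPred_eq] at hl
    change l ∈ p
    simp [hp, LinearMap.mem_ker, hl]
  have h' : ∀ᵐ l : Fin k → ℝ, ∀ i j : Fin k, i ≠ j → l i ≠ l j := by
    rw [ae_all_iff]; intro i
    rw [ae_all_iff]; intro j
    by_cases hij : i = j
    · exact ae_of_all _ fun l hc => absurd hij hc
    · filter_upwards [h i j hij] with l hl _ using hl
  filter_upwards [h'] with l hl i j hij
  by_contra hne
  exact hl i j hne hij

/-- Up to a null set the cube is the disjoint union of the images of the simplex under the `k!`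
permutations of the coordinates. -/
lemma pow_integral_eq_factorial_mul_integral_timeSimplex (k : ℕ) (f : ℝ → ℝ)
    (hf : IntegrableOn f (Set.Ioo 0 1)) :
    (∫ s in Set.Ioo (0 : ℝ) 1, f s) ^ k =
      (k.factorial : ℝ) * ∫ l in timeSimplex k, ∏ i, f (l i) := by
  set F : (Fin k → ℝ) → ℝ := fun l => ∏ i, f (l i) with hF
  set Q : Set (Fin k → ℝ) := Set.pi Set.univ (fun _ : Fin k => Set.Ioo (0 : ℝ) 1) with hQ
  have hvQ : (volume : Measure (Fin k → ℝ)).restrict Q =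
      Measure.pi (fun _ => volume.restrict (Set.Ioo (0 : ℝ) 1)) := by
    rw [volume_pi, Measure.restrict_pi_pi]
  have h1 : (∫ s in Set.Ioo (0 : ℝ) 1, f s) ^ k = ∫ l in Q, F l := by
    rw [hvQ, hF, integral_fintype_prod_eq_pow, Fintype.card_fin]
  have hFQ : IntegrableOn F Q := by
    rw [IntegrableOn, hvQ]
    exact Integrable.fintype_prod (fun _ => hf)
  set T : Equiv.Perm (Fin k) → Set (Fin k → ℝ) := fun σ => {l | l ∘ σ ∈ timeSimplex k} with hT
  have hmeas : ∀ σ : Equiv.Perm (Fin k), Measurable (fun l : Fin k → ℝ => l ∘ σ) := fun σ =>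
    measurable_pi_lambda _ fun i => measurable_pi_apply (σ i)
  have hTm : ∀ σ, MeasurableSet (T σ) := fun σ => hmeas σ (measurableSet_timeSimplex k)
  have hTQ : ∀ σ, T σ ⊆ Q := by
    intro σ l hl i _
    have := hl.2 (σ.symm i)
    simpa using this
  have hcover : Q =ᵐ[volume] ⋃ σ, T σ := by
    filter_upwards [ae_injective k] with l hl
    refine propext ⟨fun hlQ => ?_, fun h => ?_⟩
    · refine Set.mem_iUnion.2 ⟨Fin.revPerm.trans (Tuple.sort l), ?_, fun i => hlQ _ trivial⟩
      have hm : StrictMono (l ∘ Tuple.sort l) :=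
        (Tuple.monotone_sort l).strictMono_of_injective (hl.comp (Tuple.sort l).injective)
      intro i j hij
      exact hm (Fin.rev_lt_rev.2 hij)
    · obtain ⟨σ, hσ⟩ := Set.mem_iUnion.1 h
      exact hTQ σ hσ
  have hdisj : Pairwise (Function.onFun Disjoint T) := by
    intro σ τ hne
    refine Set.disjoint_left.2 fun l hσ hτ => hne ?_
    have hc := Tuple.unique_antitone hσ.1.antitone hτ.1.antitone
    ext i
    have hi : l (σ i) = l (τ i) := congrFun hc i
    have hinj : Function.Injective l := by
      intro a b hab
      have := hσ.1.injective (a₁ := σ.symm a) (a₂ := σ.symm b) (by simpa using hab)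
      exact σ.symm.injective this
    rw [hinj hi]
  have hTint : ∀ σ, ∫ l in T σ, F l = ∫ l in timeSimplex k, F l := by
    intro σ
    have hmp : MeasurePreserving (fun l : Fin k → ℝ => l ∘ σ) volume volume := by
      have := volume_measurePreserving_piCongrLeft (fun _ : Fin k => ℝ) σ.symm
      convert this using 1
      funext l i
      have h := Equiv.piCongrLeft_apply_apply (fun _ : Fin k => ℝ) σ.symm l (σ i)
      rw [Equiv.symm_apply_apply] at h
      exact h.symm
    have hemb : MeasurableEmbedding (fun l : Fin k → ℝ => l ∘ σ) := by
      have : (fun l : Fin k → ℝ => l ∘ σ) =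
          MeasurableEquiv.piCongrLeft (fun _ : Fin k => ℝ) σ.symm := by
        funext l i
        have h := Equiv.piCongrLeft_apply_apply (fun _ : Fin k => ℝ) σ.symm l (σ i)
        rw [Equiv.symm_apply_apply] at h
        exact h.symm
      rw [this]
      exact MeasurableEquiv.measurableEmbedding _
    have h := hmp.setIntegral_preimage_emb hemb F (timeSimplex k)
    rw [← h]
    refine setIntegral_congr_fun (hTm σ) fun l _ => ?_
    exact (Equiv.prod_comp σ (fun i => f (l i))).symm
  rw [h1, setIntegral_congr_set hcover, integral_iUnion_fintype hTm hdisj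
    (fun σ => hFQ.mono_set (hTQ σ)), Finset.sum_congr rfl (fun σ _ => hTint σ), Finset.sum_const,
    Finset.card_univ, Fintype.card_perm, Fintype.card_fin, nsmul_eq_mul]

/-! ### Finite-dimensional laws of the bridge -/

/-- A bridge from `x` to `y` can exist only if `p_t(x,y) ≠ 0`: otherwise the one-point law
would be the zero measure, because division by zero gives zero. -/
lemma IsStableBridge.stableKernel_ne_zero {Ω : Type*} [MeasurableSpace Ω] {α t : ℝ} (ht : 0 < t)
    {x y : E d} {X : ℝ → Ω → E d} {P : Measure Ω} (h : IsStableBridge α t x y X P) :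
    stableKernel α t x y ≠ 0 := by
  intro h0
  have := h.isProbabilityMeasure
  have h1 := h.finiteDimensional 1 (fun _ => t / 2) (Subsingleton.strictMono _)
    (fun _ => ⟨by linarith, by linarith⟩)
  have hm : Measurable (fun ω (_ : Fin 1) => X (t / 2) ω) :=
    measurable_pi_lambda _ fun _ => h.measurable _ ⟨by linarith, by linarith⟩
  have h2 := congrArg (fun μ => μ Set.univ) h1
  simp only [Measure.map_apply hm MeasurableSet.univ, Set.preimage_univ, measure_univ] at h2
  have h3 : (fun z : Fin 1 → E d =>
      ENNReal.ofReal (bridgeDensity α t x y (fun _ => t / 2) z)) = 0 := by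
    funext z
    simp [bridgeDensity, h0]
  rw [h3, withDensity_zero] at h2
  simp at h2

/-- The part `∏_i p_{t(λ_i - λ_{i+1})}(z_i, z_{i+1})` of the joint density that involves
neither end point; the times `t λ_i` are decreasing in `i`. -/
def chainDensity (α t : ℝ) {m : ℕ} (l : Fin (m + 1) → ℝ) (z : Fin (m + 1) → E d) : ℝ :=
  ∏ i : Fin m, stableKernel α (t * (l i.castSucc - l i.succ)) (z i.castSucc) (z i.succ)

/-- The joint density in `(z, y)` of the stable process started at `x`, at the decreasing times
`t λ_i` and the final time `t`. -/
def pathDensity (α t : ℝ) {m : ℕ} (x y : E d) (l : Fin (m + 1) → ℝ) (z : Fin (m + 1) → E d) : ℝ :=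
  stableKernel α (t * l (Fin.last m)) x (z (Fin.last m)) *
    (chainDensity α t l z * stableKernel α (t * (1 - l 0)) (z 0) y)

/-- `bridgeDensity` takes its times in increasing order, the simplex has them decreasing; the
reversal exchanges the arguments of each inner density, which is symmetric. -/
lemma bridgeDensity_comp_rev (α t : ℝ) {m : ℕ} (x y : E d) (l : Fin (m + 1) → ℝ)
    (z : Fin (m + 1) → E d) :
    bridgeDensity α t x y (fun i => t * l i.rev) (fun i => z i.rev) =
      pathDensity α t x y l z / stableKernel α t x y := by
  unfold bridgeDensity
  simp only
  congr 1
  rw [Fin.prod_univ_succ, Fin.prod_univ_castSucc, pathDensity, chainDensity]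
  congr 1
  · have h0 : (Fin.succ (0 : Fin (m + 2))) = Fin.succ (Fin.castSucc (0 : Fin (m + 1))) := rfl
    rw [h0, Fin.cons_succ, Fin.cons_succ, Fin.snoc_castSucc, Fin.snoc_castSucc, Fin.castSucc_zero,
      Fin.cons_zero, Fin.cons_zero, Fin.rev_zero, sub_zero]
  · congr 1
    · rw [← Equiv.prod_comp Fin.revPerm]
      refine Finset.prod_congr rfl fun i _ => ?_
      have e1 : (Fin.revPerm i).castSucc.succ.succ = (Fin.castSucc (Fin.rev i).succ).succ := rfl
      have e2 : (Fin.revPerm i).castSucc.succ.castSucc =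
        (Fin.castSucc (Fin.rev i).castSucc).succ := rfl
      rw [e1, e2, Fin.cons_succ, Fin.cons_succ, Fin.cons_succ, Fin.cons_succ, Fin.snoc_castSucc,
        Fin.snoc_castSucc, Fin.snoc_castSucc, Fin.snoc_castSucc, Fin.rev_succ, Fin.rev_castSucc,
        Fin.rev_rev, stableKernel_comm, mul_sub]
    · have e1 : (Fin.last m).succ.succ = (Fin.last (m + 1)).succ := rfl
      have e2 : (Fin.last m).succ.castSucc = (Fin.castSucc (Fin.last m)).succ := rfl
      rw [e1, e2, Fin.cons_succ, Fin.cons_succ, Fin.cons_succ, Fin.cons_succ, Fin.snoc_castSucc,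
        Fin.snoc_castSucc, Fin.snoc_last, Fin.snoc_last, Fin.rev_last, mul_sub, mul_one]

lemma measurable_chainDensity {β : Type*} [MeasurableSpace β] {α t : ℝ} {m : ℕ}
    {l : β → Fin (m + 1) → ℝ} {z : β → Fin (m + 1) → E d} (hl : Measurable l) (hz : Measurable z) :
    Measurable (fun b => chainDensity α t (l b) (z b)) := by
  unfold chainDensity
  refine Finset.measurable_prod _ fun i _ => measurable_stableKernel ?_ ?_ ?_
  · exact (((measurable_pi_apply _).comp hl).sub ((measurable_pi_apply _).comp hl)).const_mul t
  · exact (measurable_pi_apply _).comp hz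
  · exact (measurable_pi_apply _).comp hz

lemma measurable_pathDensity {β : Type*} [MeasurableSpace β] {α t : ℝ} {m : ℕ} {x y : β → E d}
    {l : β → Fin (m + 1) → ℝ} {z : β → Fin (m + 1) → E d} (hx : Measurable x) (hy : Measurable y)
    (hl : Measurable l) (hz : Measurable z) :
    Measurable (fun b => pathDensity α t (x b) (y b) (l b) (z b)) := by
  unfold pathDensity
  refine Measurable.mul ?_ (Measurable.mul (measurable_chainDensity hl hz) ?_)
  · exact measurable_stableKernel (((measurable_pi_apply _).comp hl).const_mul t) hx
      ((measurable_pi_apply _).comp hz)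
  · exact measurable_stableKernel ((((measurable_pi_apply _).comp hl).const_sub 1).const_mul t)
      ((measurable_pi_apply _).comp hz) hy

section Bridge

variable {Ω : Type*} [MeasurableSpace Ω] {α t : ℝ} {x y : E d} {X : ℝ → Ω → E d} {P : Measure Ω}

lemma timeSimplex_mul_mem (ht : 0 < t) {k : ℕ} {l : Fin k → ℝ} (hl : l ∈ timeSimplex k)
    (i : Fin k) : t * l i ∈ Set.Ioo 0 t :=
  ⟨mul_pos ht (hl.2 i).1, by have := (hl.2 i).2; nlinarith⟩

lemma measurePreserving_comp_rev (k : ℕ) :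
    MeasurePreserving (fun (z : Fin k → E d) (i : Fin k) => z i.rev) volume volume := by
  have := volume_measurePreserving_piCongrLeft (fun _ : Fin k => E d) Fin.revPerm
  convert this using 1
  funext l i
  have h := Equiv.piCongrLeft_apply_apply (fun _ : Fin k => E d) Fin.revPerm l (Fin.rev i)
  rw [Fin.revPerm_apply, Fin.rev_rev] at h
  exact h.symm

lemma IsStableBridge.map_eq (h : IsStableBridge α t x y X P) (ht : 0 < t) {m : ℕ}
    {l : Fin (m + 1) → ℝ} (hl : l ∈ timeSimplex (m + 1)) :
    P.map (fun ω i => X (t * l i) ω) = (volume : Measure (Fin (m + 1) → E d)).withDensity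
      (fun z => ENNReal.ofReal (pathDensity α t x y l z / stableKernel α t x y)) := by
  have hmem := fun i => timeSimplex_mul_mem ht hl i
  have h1 := h.finiteDimensional (m + 1) (fun i => t * l i.rev)
    (fun i j hij => mul_lt_mul_of_pos_left (hl.1 (Fin.rev_lt_rev.2 hij)) ht) (fun i => hmem _)
  have hX : Measurable (fun ω (i : Fin (m + 1)) => X (t * l i.rev) ω) :=
    measurable_pi_lambda _ fun i => h.measurable _ (Set.Ioo_subset_Icc_self (hmem _))
  have hr := measurePreserving_comp_rev (d := d) (m + 1)
  have h2 : P.map (fun ω i => X (t * l i) ω) =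
      (P.map (fun ω (i : Fin (m + 1)) => X (t * l i.rev) ω)).map (fun z i => z i.rev) := by
    rw [Measure.map_map hr.measurable hX]
    congr 1
    funext ω i
    simp
  rw [h2, h1]
  ext s hs
  rw [Measure.map_apply hr.measurable hs, withDensity_apply _ (hr.measurable hs),
    withDensity_apply _ hs]
  have hD : Measurable (fun z : Fin (m + 1) → E d =>
      ENNReal.ofReal (pathDensity α t x y l z / stableKernel α t x y)) :=
    ENNReal.measurable_ofReal.comp ((measurable_pathDensity measurable_const measurable_const
      measurable_const measurable_id).div_const _)
  rw [← hr.setLIntegral_comp_preimage hs hD]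
  refine setLIntegral_congr_fun (hr.measurable hs) fun z _ => ?_
  have := bridgeDensity_comp_rev α t x y l (fun i => z i.rev)
  simp only [Fin.rev_rev] at this
  simp only [this]

lemma IsStableBridge.measurable_apply (h : IsStableBridge α t x y X P) (ht : 0 < t) {m : ℕ}
    {l : Fin (m + 1) → ℝ} (hl : l ∈ timeSimplex (m + 1)) :
    Measurable (fun ω i => X (t * l i) ω) :=
  measurable_pi_lambda _ fun i =>
    h.measurable _ (Set.Ioo_subset_Icc_self (timeSimplex_mul_mem ht hl i))

lemma pathDensity_nonneg (hpos : ∀ t : ℝ, 0 < t → ∀ x : E d, 0 < stableDensity α t x)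
    (ht : 0 < t) {m : ℕ} {l : Fin (m + 1) → ℝ} (hl : l ∈ timeSimplex (m + 1)) (x y : E d)
    (z : Fin (m + 1) → E d) : 0 ≤ pathDensity α t x y l z := by
  refine mul_nonneg (hpos _ (mul_pos ht (hl.2 _).1) _).le
    (mul_nonneg (Finset.prod_nonneg fun i _ => ?_)
      (hpos _ (mul_pos ht (by linarith [(hl.2 0).2])) _).le)
  exact (hpos _ (mul_pos ht (sub_pos.2 (hl.1 i.castSucc_lt_succ))) _).le

lemma IsStableBridge.lintegral_eq (h : IsStableBridge α t x y X P)
    (hpos : ∀ t : ℝ, 0 < t → ∀ x : E d, 0 < stableDensity α t x) (ht : 0 < t) {m : ℕ}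
    {l : Fin (m + 1) → ℝ} (hl : l ∈ timeSimplex (m + 1)) {Φ : (Fin (m + 1) → E d) → ENNReal}
    (hΦ : Measurable Φ) :
    ENNReal.ofReal (stableKernel α t x y) * ∫⁻ ω, Φ (fun i => X (t * l i) ω) ∂P =
      ∫⁻ z, Φ z * ENNReal.ofReal (pathDensity α t x y l z) := by
  have hp : 0 < stableKernel α t x y := hpos t ht _
  have hD : Measurable (fun z : Fin (m + 1) → E d =>
      ENNReal.ofReal (pathDensity α t x y l z / stableKernel α t x y)) :=
    ENNReal.measurable_ofReal.comp ((measurable_pathDensity measurable_const measurable_const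
      measurable_const measurable_id).div_const _)
  rw [← lintegral_map hΦ (h.measurable_apply ht hl), h.map_eq ht hl,
    lintegral_withDensity_eq_lintegral_mul _ hD hΦ, ← lintegral_const_mul _ (hD.mul hΦ)]
  refine lintegral_congr fun z => ?_
  rw [Pi.mul_apply, ← mul_assoc, ← ENNReal.ofReal_mul hp.le, mul_div_cancel₀ _ hp.ne', mul_comm]

lemma IsStableBridge.integral_eq (h : IsStableBridge α t x y X P)
    (hpos : ∀ t : ℝ, 0 < t → ∀ x : E d, 0 < stableDensity α t x) (ht : 0 < t) {m : ℕ}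
    {l : Fin (m + 1) → ℝ} (hl : l ∈ timeSimplex (m + 1)) {Φ : (Fin (m + 1) → E d) → ℝ}
    (hΦ : Measurable Φ) :
    stableKernel α t x y * ∫ ω, Φ (fun i => X (t * l i) ω) ∂P =
      ∫ z, Φ z * pathDensity α t x y l z := by
  have hp : 0 < stableKernel α t x y := hpos t ht _
  have hD : Measurable (fun z : Fin (m + 1) → E d =>
      ENNReal.ofReal (pathDensity α t x y l z / stableKernel α t x y)) :=
    ENNReal.measurable_ofReal.comp ((measurable_pathDensity measurable_const measurable_const
      measurable_const measurable_id).div_const _)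
  rw [← integral_map (h.measurable_apply ht hl).aemeasurable hΦ.aestronglyMeasurable,
    h.map_eq ht hl, integral_withDensity_eq_integral_toReal_smul hD
      (ae_of_all _ fun _ => ENNReal.ofReal_lt_top), ← integral_const_mul]
  refine integral_congr_ae (ae_of_all _ fun z => ?_)
  simp only [smul_eq_mul]
  rw [ENNReal.toReal_ofReal (div_nonneg (pathDensity_nonneg hpos ht hl x y z) hp.le), ← mul_assoc,
    mul_div_cancel₀ _ hp.ne', mul_comm]

/-- Right continuity of the paths gives a jointly measurable version of `V (X_{ts})`: the limit of
the evaluations at the grid points `(⌊n s⌋ + 1) / n`, which decrease to `s` from the right. -/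
lemma IsStableBridge.exists_measurable_version (h : IsStableBridge α t x y X P) (ht : 0 < t)
    {V : E d → ℝ} (hV : Continuous V) {C : ℝ} (hC : ∀ z, |V z| ≤ C) :
    ∃ Y : ℝ → Ω → ℝ, Measurable (Function.uncurry Y) ∧ (∀ s ω, |Y s ω| ≤ C) ∧
      ∀ᵐ ω ∂P, ∀ s ∈ Set.Ioo (0 : ℝ) 1, Y s ω = V (X (t * s) ω) := by
  have hC0 : 0 ≤ C := (abs_nonneg _).trans (hC 0)
  -- grid points are clamped to `[0, 1]`, since `X` is measurable only at times in `[0, t]`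
  set c : ℤ → ℕ → ℝ := fun j n => max 0 (min 1 (((j : ℝ) + 1) / ((n : ℝ) + 1))) with hc
  set Z : ℕ → ℝ × Ω → ℝ := fun n p => V (X (t * c ⌊((n : ℝ) + 1) * p.1⌋ n) p.2) with hZ
  have hZm : ∀ n, Measurable (Z n) := by
    intro n
    have h1 : Measurable (fun q : ℤ × Ω => V (X (t * c q.1 n) q.2)) := by
      refine measurable_from_prod_countable_right fun j => ?_
      have hm : Measurable (X (t * c j n)) := by
        refine h.measurable _ ⟨?_, ?_⟩
        · exact mul_nonneg ht.le (le_max_left _ _)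
        · have : c j n ≤ 1 := max_le zero_le_one (min_le_left _ _)
          nlinarith
      exact hV.measurable.comp hm
    have h2 : Measurable (fun p : ℝ × Ω => (⌊((n : ℝ) + 1) * p.1⌋, p.2)) :=
      (Int.measurable_floor.comp (measurable_fst.const_mul _)).prodMk measurable_snd
    have h3 := h1.comp h2
    simp only [Function.comp_def] at h3
    exact h3
  -- truncation at `±C` keeps the bound also off the almost sure event of convergence
  refine ⟨fun s ω => max (-C) (min C (limsup (fun n => Z n (s, ω)) atTop)), ?_, ?_, ?_⟩
  · exact measurable_const.max (measurable_const.min (Measurable.limsup hZm))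
  · intro s ω
    refine abs_le.2 ⟨le_max_left _ _, max_le (by linarith) (min_le_left _ _)⟩
  · filter_upwards [h.rightContinuous] with ω hω s hs
    have hts : t * s ∈ Set.Ico 0 t := ⟨mul_nonneg ht.le hs.1.le, by have := hs.2; nlinarith⟩
    have hinv : Tendsto (fun n : ℕ => ((n : ℝ) + 1)⁻¹) atTop (𝓝 0) :=
      (tendsto_atTop_add_const_right _ 1 tendsto_natCast_atTop_atTop).inv_tendsto_atTop
    have hgt : ∀ n : ℕ, s < ((⌊((n : ℝ) + 1) * s⌋ : ℝ) + 1) / ((n : ℝ) + 1) := by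
      intro n
      rw [lt_div_iff₀ (by positivity), mul_comm]
      exact Int.lt_floor_add_one _
    have hle : ∀ n : ℕ, ((⌊((n : ℝ) + 1) * s⌋ : ℝ) + 1) / ((n : ℝ) + 1) ≤ s + ((n : ℝ) + 1)⁻¹ := by
      intro n
      have := Int.floor_le (((n : ℝ) + 1) * s)
      rw [div_le_iff₀ (by positivity), add_mul s, inv_mul_cancel₀ (by positivity)]
      linarith
    have hlim : Tendsto (fun n : ℕ => ((⌊((n : ℝ) + 1) * s⌋ : ℝ) + 1) / ((n : ℝ) + 1)) atTop
        (𝓝 s) := by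
      refine tendsto_of_tendsto_of_tendsto_of_le_of_le tendsto_const_nhds
        (by simpa using hinv.const_add s) (fun n => (hgt n).le) hle
    have hlimc : Tendsto (fun n : ℕ => t * c ⌊((n : ℝ) + 1) * s⌋ n) atTop
        (𝓝[Set.Ici (t * s)] (t * s)) := by
      refine tendsto_nhdsWithin_iff.2 ⟨?_, ?_⟩
      · have h1 := ((tendsto_const_nhds (x := (0 : ℝ))).max
          ((tendsto_const_nhds (x := (1 : ℝ))).min hlim)).const_mul t
        rwa [min_eq_right hs.2.le, max_eq_right hs.1.le] at h1
      · refine Eventually.of_forall fun n => ?_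
        refine mul_le_mul_of_nonneg_left ?_ ht.le
        exact (le_min hs.2.le (hgt n).le).trans (le_max_right _ _)
    have hT : Tendsto (fun n => Z n (s, ω)) atTop (𝓝 (V (X (t * s) ω))) :=
      (hV.tendsto _).comp ((hω (t * s) hts).tendsto.comp hlimc)
    rw [hT.limsup_eq, min_eq_right ((le_abs_self _).trans (hC _)),
      max_eq_right (abs_le.1 (hC _)).1]

end Bridge

/-! ### Moments of the potential along the bridge -/

lemma integrable_stableKernel_left (hd : 1 ≤ d) {α t : ℝ} (hα : 0 < α) (ht : 0 < t)
    (hpos : ∀ t : ℝ, 0 < t → ∀ x : E d, 0 < stableDensity α t x) (z : E d) :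
    Integrable (fun x => stableKernel α t x z) ∧ ∫ x, stableKernel α t x z = 1 := by
  obtain ⟨h1, h2⟩ := stableDensity_integrable_and_integral hd hα ht (fun x => (hpos t ht x).le)
  refine ⟨h1.comp_sub_right z, ?_⟩
  rw [← h2]
  exact integral_sub_right_eq_self _ z

lemma integrable_stableKernel_right (hd : 1 ≤ d) {α t : ℝ} (hα : 0 < α) (ht : 0 < t)
    (hpos : ∀ t : ℝ, 0 < t → ∀ x : E d, 0 < stableDensity α t x) (z : E d) :
    Integrable (fun x => stableKernel α t z x) ∧ ∫ x, stableKernel α t z x = 1 := by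
  simp only [stableKernel_comm α t z]
  exact integrable_stableKernel_left hd hα ht hpos z

/-- Integrating out the two end points leaves the inner chain. -/
lemma integral_pathDensity (hd : 1 ≤ d) {α t : ℝ} (hα : 0 < α) (ht : 0 < t)
    (hpos : ∀ t : ℝ, 0 < t → ∀ x : E d, 0 < stableDensity α t x) {m : ℕ} {l : Fin (m + 1) → ℝ}
    (hl : l ∈ timeSimplex (m + 1)) (z : Fin (m + 1) → E d) :
    Integrable (fun q : E d × E d => pathDensity α t q.1 q.2 l z) ∧
    ∫ q : E d × E d, pathDensity α t q.1 q.2 l z = chainDensity α t l z := by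
  obtain ⟨h1, h2⟩ := integrable_stableKernel_left hd hα (mul_pos ht (hl.2 (Fin.last m)).1) hpos
    (z (Fin.last m))
  obtain ⟨h3, h4⟩ := integrable_stableKernel_right hd hα
    (mul_pos ht (sub_pos.2 (hl.2 0).2)) hpos (z 0)
  unfold pathDensity
  refine ⟨h1.mul_prod (h3.const_mul _), ?_⟩
  rw [Measure.volume_eq_prod, integral_prod_mul (μ := (volume : Measure (E d)))
    (ν := (volume : Measure (E d)))
    (fun x => stableKernel α (t * l (Fin.last m)) x (z (Fin.last m)))
    (fun y => chainDensity α t l z * stableKernel α (t * (1 - l 0)) (z 0) y), h2,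
    integral_const_mul, h4, one_mul, mul_one]

lemma lintegral_pathDensity (hd : 1 ≤ d) {α t : ℝ} (hα : 0 < α) (ht : 0 < t)
    (hpos : ∀ t : ℝ, 0 < t → ∀ x : E d, 0 < stableDensity α t x) {m : ℕ} {l : Fin (m + 1) → ℝ}
    (hl : l ∈ timeSimplex (m + 1)) (z : Fin (m + 1) → E d) :
    ∫⁻ q : E d × E d, ENNReal.ofReal (pathDensity α t q.1 q.2 l z) =
      ENNReal.ofReal (chainDensity α t l z) := by
  obtain ⟨h1, h2⟩ := integral_pathDensity hd hα ht hpos hl z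
  rw [← h2, ofReal_integral_eq_lintegral_ofReal h1
    (ae_of_all _ fun q => pathDensity_nonneg hpos ht hl q.1 q.2 z)]

/-- The mean `∫_0^1 V(X_{ts}) ds` of the potential along the path. -/
def pathMean {Ω : Type*} (V : E d → ℝ) (X : ℝ → Ω → E d) (t : ℝ) (ω : Ω) : ℝ :=
  ∫ s in Set.Ioo (0 : ℝ) 1, V (X (t * s) ω)

lemma abs_pathMean_le {Ω : Type*} {V : E d → ℝ} {X : ℝ → Ω → E d} {t C : ℝ}
    (hC : ∀ z, |V z| ≤ C) (ω : Ω) : |pathMean V X t ω| ≤ C := by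
  have := norm_setIntegral_le_of_norm_le_const (μ := volume) (s := Set.Ioo (0 : ℝ) 1)
    (f := fun s => V (X (t * s) ω)) (C := C) (by simp) (fun s _ => hC _)
  simpa [pathMean] using this

section Moments

variable {Ω : Type*} [MeasurableSpace Ω] {α t : ℝ} {X : ℝ → Ω → E d} {P : E d → E d → Measure Ω}
  {V : E d → ℝ} {C : ℝ}

/-- For times in the simplex, all but one factor of the product are bounded by `C`; the
one-point law of the bridge then integrates to `∫ |V|`, whatever the time. -/
lemma lintegral_prod_mul_pathDensity_le (hd : 1 ≤ d) (hα : 0 < α) (ht : 0 < t)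
    (hpos : ∀ t : ℝ, 0 < t → ∀ x : E d, 0 < stableDensity α t x)
    (hP : ∀ x y, IsStableBridge α t x y X (P x y))
    (hV : Continuous V) (hC : ∀ z, |V z| ≤ C) {m : ℕ} {l : Fin (m + 1) → ℝ}
    (hl : l ∈ timeSimplex (m + 1)) :
    ∫⁻ q : E d × E d, ∫⁻ z : Fin (m + 1) → E d,
      ‖∏ i, V (z i)‖ₑ * ENNReal.ofReal (pathDensity α t q.1 q.2 l z) ≤
    ENNReal.ofReal C ^ m * ∫⁻ z, ‖V z‖ₑ := by
  -- the single time `t λ_1`, whose factor `V` is kept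
  set l' : Fin (0 + 1) → ℝ := fun _ => l 0 with hl'
  have hl'mem : l' ∈ timeSimplex (0 + 1) :=
    ⟨Subsingleton.strictAnti (α := Fin 1) _, fun _ => hl.2 0⟩
  have hVm : Measurable (fun z : Fin (m + 1) → E d => ‖∏ i, V (z i)‖ₑ) :=
    (Finset.measurable_prod _ fun i _ => hV.measurable.comp (measurable_pi_apply i)).enorm
  have hVm' : ∀ n : ℕ, Measurable (fun z : Fin (n + 1) → E d => ‖V (z 0)‖ₑ) := fun n =>
    (hV.measurable.comp (measurable_pi_apply 0)).enorm
  have hstep : ∀ q : E d × E d, ∫⁻ z : Fin (m + 1) → E d,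
      ‖∏ i, V (z i)‖ₑ * ENNReal.ofReal (pathDensity α t q.1 q.2 l z) ≤
      ENNReal.ofReal C ^ m * ∫⁻ z : Fin (0 + 1) → E d,
        ‖V (z 0)‖ₑ * ENNReal.ofReal (pathDensity α t q.1 q.2 l' z) := by
    intro q
    rw [← (hP q.1 q.2).lintegral_eq hpos ht hl hVm,
      ← (hP q.1 q.2).lintegral_eq hpos ht hl'mem (hVm' 0), mul_left_comm]
    refine mul_le_mul_right ?_ _
    rw [← lintegral_const_mul']
    · refine lintegral_mono fun ω => ?_
      rw [Fin.prod_univ_succ, enorm_mul, mul_comm]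
      refine mul_le_mul_left ?_ _
      rw [Real.enorm_eq_ofReal_abs, ← ENNReal.ofReal_pow ((abs_nonneg _).trans (hC 0)),
        Finset.abs_prod]
      refine ENNReal.ofReal_le_ofReal ?_
      refine (Finset.prod_le_prod (fun i _ => abs_nonneg _) (fun i _ => hC _)).trans ?_
      simp
    · exact ENNReal.pow_ne_top ENNReal.ofReal_ne_top
  refine (lintegral_mono hstep).trans ?_
  rw [lintegral_const_mul' _ _ (ENNReal.pow_ne_top ENNReal.ofReal_ne_top)]
  refine mul_le_mul_right ?_ _
  have hpm : Measurable (fun r : (E d × E d) × (Fin (0 + 1) → E d) =>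
      ‖V (r.2 0)‖ₑ * ENNReal.ofReal (pathDensity α t r.1.1 r.1.2 l' r.2)) :=
    ((hVm' 0).comp measurable_snd).mul (ENNReal.measurable_ofReal.comp
      (measurable_pathDensity measurable_fst.fst measurable_fst.snd measurable_const
        measurable_snd))
  rw [lintegral_lintegral_swap hpm.aemeasurable]
  have h1 : ∀ z : Fin (0 + 1) → E d, ∫⁻ q : E d × E d,
      ‖V (z 0)‖ₑ * ENNReal.ofReal (pathDensity α t q.1 q.2 l' z) = ‖V (z 0)‖ₑ := by
    intro z
    rw [lintegral_const_mul' _ _ enorm_ne_top, lintegral_pathDensity hd hα ht hpos hl'mem]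
    simp [chainDensity]
  simp only [h1]
  have h2 := (volume_preserving_funUnique (Fin 1) (E d)).lintegral_comp
    (f := fun z => ‖V z‖ₑ) hV.measurable.enorm
  exact h2.le

/-- The joint integrand in the times, the end points and the intermediate positions is absolutely
integrable, so that these integrals can be taken in any order. -/
lemma integrable_prod_mul_pathDensity (hd : 1 ≤ d) (hα : 0 < α) (ht : 0 < t)
    (hpos : ∀ t : ℝ, 0 < t → ∀ x : E d, 0 < stableDensity α t x)
    (hP : ∀ x y, IsStableBridge α t x y X (P x y))
    (hV : Continuous V) (hC : ∀ z, |V z| ≤ C) (hVi : Integrable V) (m : ℕ) :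
    Integrable (fun r : (Fin (m + 1) → ℝ) × ((E d × E d) × (Fin (m + 1) → E d)) =>
      (∏ i, V (r.2.2 i)) * pathDensity α t r.2.1.1 r.2.1.2 r.1 r.2.2)
      ((volume.restrict (timeSimplex (m + 1))).prod (volume.prod volume)) := by
  have hVm : Measurable (fun z : Fin (m + 1) → E d => ∏ i, V (z i)) :=
    Finset.measurable_prod _ fun i _ => hV.measurable.comp (measurable_pi_apply i)
  have hm : Measurable (fun r : (Fin (m + 1) → ℝ) × ((E d × E d) × (Fin (m + 1) → E d)) =>
      (∏ i, V (r.2.2 i)) * pathDensity α t r.2.1.1 r.2.1.2 r.1 r.2.2) :=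
    (hVm.comp measurable_snd.snd).mul (measurable_pathDensity measurable_snd.fst.fst
      measurable_snd.fst.snd measurable_fst measurable_snd.snd)
  refine ⟨hm.aestronglyMeasurable, ?_⟩
  rw [HasFiniteIntegral, lintegral_prod _ hm.enorm.aemeasurable]
  have hbound : ∀ l ∈ timeSimplex (m + 1), ∫⁻ r : (E d × E d) × (Fin (m + 1) → E d),
      ‖(∏ i, V (r.2 i)) * pathDensity α t r.1.1 r.1.2 l r.2‖ₑ ∂(volume.prod volume) ≤
      ENNReal.ofReal C ^ m * ∫⁻ z, ‖V z‖ₑ := by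
    intro l hl
    have hm' : Measurable (fun r : (E d × E d) × (Fin (m + 1) → E d) =>
        (∏ i, V (r.2 i)) * pathDensity α t r.1.1 r.1.2 l r.2) :=
      (hVm.comp measurable_snd).mul (measurable_pathDensity measurable_fst.fst
        measurable_fst.snd measurable_const measurable_snd)
    rw [lintegral_prod _ hm'.enorm.aemeasurable]
    refine le_trans (le_of_eq ?_) (lintegral_prod_mul_pathDensity_le hd hα ht hpos hP hV hC hl)
    refine lintegral_congr fun q => lintegral_congr fun z => ?_
    rw [enorm_mul, Real.enorm_of_nonneg (pathDensity_nonneg hpos ht hl _ _ _)]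
  refine (setLIntegral_mono measurable_const hbound).trans_lt ?_
  rw [setLIntegral_const]
  refine ENNReal.mul_lt_top (ENNReal.mul_lt_top (ENNReal.pow_lt_top ENNReal.ofReal_lt_top)
    hVi.2) ((volume_timeSimplex_le_one _).trans_lt ENNReal.one_lt_top)

/-- The `k`-th moment of the path mean under the bridge, weighted by `p_t(x,y)`. -/
def weightedMoment (α : ℝ) (V : E d → ℝ) (X : ℝ → Ω → E d) (P : E d → E d → Measure Ω) (t : ℝ)
    (k : ℕ) (q : E d × E d) : ℝ :=
  stableKernel α t q.1 q.2 * ∫ ω, pathMean V X t ω ^ k ∂(P q.1 q.2)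

lemma IsStableBridge.aestronglyMeasurable_pathMean {P : Measure Ω} {x y : E d}
    (h : IsStableBridge α t x y X P) (ht : 0 < t) (hV : Continuous V) (hC : ∀ z, |V z| ≤ C) :
    AEStronglyMeasurable (pathMean V X t) P := by
  obtain ⟨Y, hYm, hYC, hY⟩ := h.exists_measurable_version ht hV hC
  have h1 : StronglyMeasurable (fun ω => ∫ s in Set.Ioo (0 : ℝ) 1, Y s ω) :=
    (hYm.comp measurable_swap).stronglyMeasurable.integral_prod_right'
      (f := fun p : Ω × ℝ => Y p.2 p.1)
  refine ⟨_, h1, ?_⟩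
  filter_upwards [hY] with ω hω
  exact (setIntegral_congr_fun measurableSet_Ioo fun s hs => hω s hs).symm

/-- Fubini's theorem is applied to the jointly measurable version of the path; for times in the
simplex the mean over `ω` is given by the finite-dimensional laws. -/
lemma weightedMoment_eq
    (hpos : ∀ t : ℝ, 0 < t → ∀ x : E d, 0 < stableDensity α t x) (ht : 0 < t)
    (hP : ∀ x y, IsStableBridge α t x y X (P x y))
    (hV : Continuous V) (hC : ∀ z, |V z| ≤ C) (m : ℕ) (q : E d × E d) :
    weightedMoment α V X P t (m + 1) q = ((m + 1).factorial : ℝ) *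
      ∫ l in timeSimplex (m + 1), ∫ z : Fin (m + 1) → E d,
        (∏ i, V (z i)) * pathDensity α t q.1 q.2 l z := by
  have hb := hP q.1 q.2
  have := hb.isProbabilityMeasure
  obtain ⟨Y, hYm, hYC, hY⟩ := hb.exists_measurable_version ht hV hC
  have hYs : ∀ ω, Measurable (fun s => Y s ω) := fun ω => hYm.comp measurable_prodMk_right
  have h1 : ∫ ω, pathMean V X t ω ^ (m + 1) ∂(P q.1 q.2) =
      ∫ ω, ((m + 1).factorial : ℝ) * (∫ l in timeSimplex (m + 1), ∏ i, Y (l i) ω)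
        ∂(P q.1 q.2) := by
    refine integral_congr_ae ?_
    filter_upwards [hY] with ω hω
    have hint : IntegrableOn (fun s => Y s ω) (Set.Ioo 0 1) :=
      Measure.integrableOn_of_bounded (M := C) (by simp) (hYs ω).aestronglyMeasurable
        (ae_of_all _ fun s => hYC s ω)
    rw [← pow_integral_eq_factorial_mul_integral_timeSimplex _ _ hint, pathMean]
    congr 1
    exact setIntegral_congr_fun measurableSet_Ioo fun s hs => (hω s hs).symm
  have hjm : Measurable (fun r : Ω × (Fin (m + 1) → ℝ) => ∏ i, Y (r.2 i) r.1) := by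
    refine Finset.measurable_prod _ fun i _ => ?_
    have hp : Measurable (fun r : Ω × (Fin (m + 1) → ℝ) => (r.2 i, r.1)) :=
      ((measurable_pi_apply i).comp measurable_snd).prodMk measurable_fst
    exact hYm.comp hp
  have hji : Integrable (fun r : Ω × (Fin (m + 1) → ℝ) => ∏ i, Y (r.2 i) r.1)
      ((P q.1 q.2).prod (volume.restrict (timeSimplex (m + 1)))) := by
    refine Integrable.of_bound hjm.aestronglyMeasurable (C ^ (m + 1)) (ae_of_all _ fun r => ?_)
    rw [Real.norm_eq_abs, Finset.abs_prod]
    refine (Finset.prod_le_prod (fun i _ => abs_nonneg _) (fun i _ => hYC _ _)).trans ?_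
    simp
  rw [weightedMoment, h1, integral_const_mul, integral_integral_swap hji, mul_left_comm,
    ← integral_const_mul]
  congr 1
  refine setIntegral_congr_fun (measurableSet_timeSimplex _) fun l hl => ?_
  rw [← hb.integral_eq hpos ht hl (Φ := fun z => ∏ i, V (z i))
    (Finset.measurable_prod _ fun i _ => hV.measurable.comp (measurable_pi_apply i))]
  congr 1
  refine integral_congr_ae ?_
  filter_upwards [hY] with ω hω
  exact Finset.prod_congr rfl fun i _ => hω _ (hl.2 i)

/-- The end points are integrated out first, each outer density having mass one. -/
lemma integrable_weightedMoment (hd : 1 ≤ d) (hα : 0 < α) (ht : 0 < t)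
    (hpos : ∀ t : ℝ, 0 < t → ∀ x : E d, 0 < stableDensity α t x)
    (hP : ∀ x y, IsStableBridge α t x y X (P x y))
    (hV : Continuous V) (hC : ∀ z, |V z| ≤ C) (hVi : Integrable V) (m : ℕ) :
    Integrable (weightedMoment α V X P t (m + 1)) ∧
    ∫ q, weightedMoment α V X P t (m + 1) q = ((m + 1).factorial : ℝ) *
      ∫ l in timeSimplex (m + 1), ∫ z : Fin (m + 1) → E d,
        (∏ i, V (z i)) * chainDensity α t l z := by
  have hH := integrable_prod_mul_pathDensity hd hα ht hpos hP hV hC hVi m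
  -- the inner integral over the positions is integrable in the times and the end points
  have hG : Integrable (fun r : (Fin (m + 1) → ℝ) × (E d × E d) => ∫ z : Fin (m + 1) → E d,
      (∏ i, V (z i)) * pathDensity α t r.2.1 r.2.2 r.1 z)
      ((volume.restrict (timeSimplex (m + 1))).prod volume) := by
    have h1 := (measurePreserving_prodAssoc (volume.restrict (timeSimplex (m + 1)))
      (volume : Measure (E d × E d)) (volume : Measure (Fin (m + 1) → E d))).integrable_comp_emb
      (MeasurableEquiv.measurableEmbedding _) |>.2 hH
    exact h1.integral_prod_left
  have heq : weightedMoment α V X P t (m + 1) = fun q => ((m + 1).factorial : ℝ) *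
      ∫ l in timeSimplex (m + 1), ∫ z : Fin (m + 1) → E d,
        (∏ i, V (z i)) * pathDensity α t q.1 q.2 l z :=
    funext fun q => weightedMoment_eq hpos ht hP hV hC m q
  rw [heq]
  refine ⟨hG.integral_prod_right.const_mul _, ?_⟩
  rw [integral_const_mul]
  congr 1
  rw [← integral_integral_swap hG]
  refine integral_congr_ae ?_
  filter_upwards [hH.prod_right_ae, ae_restrict_mem (measurableSet_timeSimplex _)] with l hHl hl
  rw [integral_integral_swap hHl]
  refine integral_congr_ae (ae_of_all _ fun z => ?_)
  simp only
  rw [integral_const_mul, (integral_pathDensity hd hα ht hpos hl z).2]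

end Moments

/-! ### Fourier representation of the chain integral -/

lemma norm_cexp_neg_I_mul (r : ℝ) : ‖Complex.exp (-(Complex.I * (r : ℂ)))‖ = 1 := by
  have : -(Complex.I * (r : ℂ)) = ((-r : ℝ) : ℂ) * Complex.I := by push_cast; ring
  rw [this, Complex.norm_exp_ofReal_mul_I]

lemma continuous_fourierHat {V : E d → ℝ} (hV : Integrable V) : Continuous (fourierHat V) := by
  unfold fourierHat
  refine continuous_of_dominated (bound := fun x => ‖V x‖) (fun ξ => ?_)
    (fun ξ => ae_of_all _ fun x => ?_) hV.norm (ae_of_all _ fun x => by fun_prop)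
  · exact (Continuous.aestronglyMeasurable (by fun_prop)).mul hV.ofReal.aestronglyMeasurable
  · rw [norm_mul, norm_cexp_neg_I_mul, one_mul, Complex.norm_real]

/-- The partial sums `θ_1 + ⋯ + θ_i`. -/
def partialSums {m : ℕ} (θ : Fin m → E d) (i : Fin m) : E d := ∑ j ∈ Finset.Iic i, θ j

lemma continuous_partialSums (m : ℕ) : Continuous (partialSums (d := d) (m := m)) := by
  unfold partialSums
  fun_prop

lemma partialSums_castSucc {m : ℕ} (θ : Fin (m + 1) → E d) (i : Fin m) :
    partialSums θ i.castSucc = partialSums (fun j : Fin m => θ j.castSucc) i := by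
  unfold partialSums
  rw [← Fin.map_castSuccEmb_Iic, Finset.sum_map]
  rfl

lemma partialSums_last {m : ℕ} (θ : Fin (m + 1) → E d) :
    partialSums θ (Fin.last m) = (∑ j : Fin m, θ j.castSucc) + θ (Fin.last m) := by
  unfold partialSums
  rw [← Fin.sum_univ_castSucc]
  congr 1
  ext j
  simp [Fin.le_last]

/-- Taking partial sums is a shear, one coordinate at a time. -/
lemma measurePreserving_partialSums (m : ℕ) :
    MeasurePreserving (partialSums (d := d) (m := m)) volume volume := by
  induction m with
  | zero =>
    have : partialSums (d := d) (m := 0) = id := Subsingleton.elim _ _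
    rw [this]
    exact MeasurePreserving.id _
  | succ m ih =>
    set e := MeasurableEquiv.piFinSuccAbove (fun _ : Fin (m + 1) => E d) (Fin.last m) with he
    have hmp : MeasurePreserving e volume volume :=
      volume_preserving_piFinSuccAbove (fun _ : Fin (m + 1) => E d) (Fin.last m)
    have hskew : MeasurePreserving (fun p : (Fin m → E d) × E d =>
        (partialSums p.1, (∑ j, p.1 j) + p.2)) (volume.prod volume) (volume.prod volume) := by
      refine ih.skew_product (g := fun a b => (∑ j, a j) + b) ?_ (ae_of_all _ fun a => ?_)
      · exact Continuous.measurable (by fun_prop)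
      · exact map_add_left_eq_self _ _
    have h := (hmp.symm e).comp ((Measure.measurePreserving_swap).comp
      (hskew.comp ((Measure.measurePreserving_swap).comp hmp)))
    have hinit : ∀ θ' : Fin (m + 1) → E d, (e θ').2 = fun j => θ' j.castSucc := by
      intro θ'
      funext j
      simp [he, MeasurableEquiv.piFinSuccAbove, Fin.insertNthEquiv, Fin.init]
    have hlast : ∀ θ' : Fin (m + 1) → E d, (e θ').1 = θ' (Fin.last m) := by
      intro θ'
      simp [he, MeasurableEquiv.piFinSuccAbove, Fin.insertNthEquiv]
    have hfun : partialSums (d := d) (m := m + 1) = e.symm ∘ Prod.swap ∘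
        (fun p : (Fin m → E d) × E d => (partialSums p.1, (∑ j, p.1 j) + p.2)) ∘
          Prod.swap ∘ e := by
      funext θ
      symm
      change e.symm _ = _
      rw [MeasurableEquiv.symm_apply_eq]
      refine Prod.ext ?_ ?_
      · rw [hlast, partialSums_last]
        simp [hinit, hlast]
      · rw [hinit]
        funext j
        simp [hinit, partialSums_castSucc]
    rw [hfun]
    exact h

/-- The frequency at the position `z_i` when the increments `z_i - z_{i+1}` carry the
frequencies `ξ_i`. -/
def nodeFrequency {m : ℕ} (ξ : Fin m → E d) (i : Fin (m + 1)) : E d :=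
  Fin.snoc (α := fun _ => E d) ξ 0 i - Fin.cons (α := fun _ => E d) 0 ξ i

lemma sum_inner_sub_eq {m : ℕ} (z : Fin (m + 1) → E d) (ξ : Fin m → E d) :
    ∑ i : Fin m, inner ℝ (z i.castSucc - z i.succ) (ξ i) =
      ∑ i : Fin (m + 1), inner ℝ (z i) (nodeFrequency ξ i) := by
  simp only [nodeFrequency, inner_sub_right, inner_sub_left, Finset.sum_sub_distrib]
  congr 1
  · rw [Fin.sum_univ_castSucc]
    simp
  · rw [Fin.sum_univ_succ]
    simp

lemma nodeFrequency_partialSums_castSucc {m : ℕ} (θ : Fin m → E d) (i : Fin m) :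
    nodeFrequency (partialSums θ) i.castSucc = θ i := by
  rw [nodeFrequency, Fin.snoc_castSucc]
  have hT : ∀ k : Fin (m + 1), Fin.cons (α := fun _ => E d) 0 (partialSums θ) k =
      ∑ j ∈ Finset.univ.filter (fun j : Fin m => j.castSucc < k), θ j := by
    intro k
    refine Fin.cases ?_ (fun i => ?_) k
    · simp
    · rw [Fin.cons_succ, partialSums]
      congr 1
      ext j
      simp [Fin.castSucc_lt_succ_iff]
  rw [hT, partialSums, ← Finset.Iio_insert, Finset.sum_insert (by simp)]
  have : Finset.univ.filter (fun j : Fin m => j.castSucc < i.castSucc) = Finset.Iio i := by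
    ext j; simp
  rw [this, add_sub_cancel_right]

lemma nodeFrequency_partialSums_last {m : ℕ} (θ : Fin m → E d) :
    nodeFrequency (partialSums θ) (Fin.last m) = -∑ i, θ i := by
  rw [nodeFrequency, Fin.snoc_last, zero_sub]
  congr 1
  cases m with
  | zero => simp [show Fin.last 0 = 0 from rfl]
  | succ m =>
    rw [← Fin.succ_last, Fin.cons_succ, partialSums_last, ← Fin.sum_univ_castSucc]

/-- The Fourier weight `V̂(-∑ θ_i) ∏ V̂(θ_i)`. -/
def fourierWeight (V : E d → ℝ) {m : ℕ} (θ : Fin m → E d) : ℂ :=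
  fourierHat V (-∑ i, θ i) * ∏ i, fourierHat V (θ i)

/-- Summation by parts in the exponent splits the integral into one Fourier transform of `V` per
position. -/
lemma integral_prod_mul_cexp (V : E d → ℝ) {m : ℕ} (ξ : Fin m → E d) :
    ∫ z : Fin (m + 1) → E d, (∏ i, (V (z i) : ℂ)) *
      ∏ i : Fin m, Complex.exp (-(Complex.I * ((inner ℝ (z i.castSucc - z i.succ) (ξ i) : ℝ) : ℂ)))
    = ∏ i : Fin (m + 1), fourierHat V (nodeFrequency ξ i) := by
  simp only [fourierHat]
  rw [← integral_fintype_prod_volume_eq_prod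
    (fun (i : Fin (m + 1)) (x : E d) =>
      Complex.exp (-(Complex.I * ((inner ℝ x (nodeFrequency ξ i) : ℝ) : ℂ))) * (V x : ℂ))]
  congr 1
  funext z
  rw [Finset.prod_mul_distrib, mul_comm, ← Complex.exp_sum, ← Complex.exp_sum,
    Finset.sum_neg_distrib, Finset.sum_neg_distrib, ← Finset.mul_sum, ← Finset.mul_sum,
    ← Complex.ofReal_sum, ← Complex.ofReal_sum, sum_inner_sub_eq]

/-- Insert the Fourier integral for every transition density, exchange the integrals, and pass
from the frequencies `ξ_i` of the increments to `θ_i = ξ_i - ξ_{i-1}`. -/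
lemma integral_chain_eq_fourier (hd : 1 ≤ d) {α : ℝ} (hα : 0 < α) {V : E d → ℝ}
    (hVi : Integrable V) {m : ℕ} (a : Fin m → ℝ) (ha : ∀ i, 0 < a i) :
    ((∫ z : Fin (m + 1) → E d, (∏ i, V (z i)) *
      ∏ i : Fin m, stableKernel α (a i) (z i.castSucc) (z i.succ) : ℝ) : ℂ) =
    ((((2 * Real.pi) ^ (d * m))⁻¹ : ℝ) : ℂ) * ∫ θ : Fin m → E d, fourierWeight V θ *
      ((Real.exp (-∑ i, a i * ‖partialSums θ i‖ ^ α) : ℝ) : ℂ) := by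
  have hc := continuous_norm_rpow (d := d) hα.le
  set g : Fin m → E d → ℂ := fun i ξ => (Real.exp (-a i * ‖ξ‖ ^ α) : ℂ) with hg
  have hgc : ∀ i, Continuous (g i) := fun i => by fun_prop
  have hgi : ∀ i, Integrable (g i) := fun i =>
    (integrable_exp_neg_norm_rpow hd hα (ha i)).ofReal
  set e : (Fin (m + 1) → E d) → (Fin m → E d) → ℂ := fun z ξ =>
    ∏ i : Fin m, Complex.exp (-(Complex.I * ((inner ℝ (z i.castSucc - z i.succ) (ξ i) : ℝ) : ℂ)))
    with he
  have hkernel : ∀ z : Fin (m + 1) → E d,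
      (((∏ i, V (z i)) * ∏ i : Fin m, stableKernel α (a i) (z i.castSucc) (z i.succ) : ℝ) : ℂ) =
      ((((2 * Real.pi) ^ (d * m))⁻¹ : ℝ) : ℂ) *
        ∫ ξ : Fin m → E d, ((∏ i, (V (z i) : ℂ)) * ∏ i, g i (ξ i)) * e z ξ := by
    intro z
    have h1 : ∏ i : Fin m, (stableKernel α (a i) (z i.castSucc) (z i.succ) : ℂ) =
        ((((2 * Real.pi) ^ (d * m))⁻¹ : ℝ) : ℂ) * ∫ ξ : Fin m → E d, ∏ i,
          (Complex.exp (-(Complex.I * ((inner ℝ (z i.castSucc - z i.succ) (ξ i) : ℝ) : ℂ))) *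
            g i (ξ i)) := by
      rw [integral_fintype_prod_volume_eq_prod (fun (i : Fin m) (ξ : E d) =>
        Complex.exp (-(Complex.I * ((inner ℝ (z i.castSucc - z i.succ) ξ : ℝ) : ℂ))) * g i ξ)]
      simp only [stableKernel, stableDensity_eq_integral_cexp hd hα (ha _),
        Finset.prod_mul_distrib, Finset.prod_const, Finset.card_univ, Fintype.card_fin]
      congr 1
      push_cast
      rw [pow_mul, inv_pow]
    rw [Complex.ofReal_mul, Complex.ofReal_prod, Complex.ofReal_prod, h1, mul_left_comm,
      ← integral_const_mul]
    congr 2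
    funext ξ
    rw [Finset.prod_mul_distrib, he]
    ring
  have hVp : Integrable (fun z : Fin (m + 1) → E d => ∏ i, (V (z i) : ℂ)) :=
    Integrable.fintype_prod (f := fun _ x => (V x : ℂ)) (fun _ => hVi.ofReal)
  have hgp : Integrable (fun ξ : Fin m → E d => ∏ i, g i (ξ i)) :=
    Integrable.fintype_prod (f := g) hgi
  have hint : Integrable (fun p : (Fin (m + 1) → E d) × (Fin m → E d) =>
      ((∏ i, (V (p.1 i) : ℂ)) * ∏ i, g i (p.2 i)) * e p.1 p.2) (volume.prod volume) := by
    refine (hVp.mul_prod hgp).mul_bdd (c := 1) (Continuous.aestronglyMeasurable ?_)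
      (ae_of_all _ fun p => ?_)
    · fun_prop
    · rw [he, norm_prod]
      simp [norm_cexp_neg_I_mul]
  rw [← integral_complex_ofReal]
  simp only [hkernel]
  rw [integral_const_mul, integral_integral_swap hint]
  congr 1
  have hin : ∀ ξ : Fin m → E d, ∫ z : Fin (m + 1) → E d,
      ((∏ i, (V (z i) : ℂ)) * ∏ i, g i (ξ i)) * e z ξ =
      (∏ i : Fin (m + 1), fourierHat V (nodeFrequency ξ i)) * ∏ i, g i (ξ i) := by
    intro ξ
    rw [← integral_prod_mul_cexp, ← integral_mul_const]
    congr 1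
    funext z
    rw [he]
    ring
  simp only [hin]
  have hmp := measurePreserving_partialSums (d := d) m
  have hcont : Continuous (fun ξ : Fin m → E d =>
      (∏ i : Fin (m + 1), fourierHat V (nodeFrequency ξ i)) * ∏ i, g i (ξ i)) := by
    have hf := continuous_fourierHat hVi
    refine (continuous_finsetProd _ fun i _ => hf.comp ?_).mul (by fun_prop)
    unfold nodeFrequency
    refine Continuous.sub ?_ ?_
    · refine Fin.lastCases ?_ (fun j => ?_) i
      · simp only [Fin.snoc_last]; fun_prop
      · simp only [Fin.snoc_castSucc]; fun_prop
    · refine Fin.cases ?_ (fun j => ?_) i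
      · simp only [Fin.cons_zero]; fun_prop
      · simp only [Fin.cons_succ]; fun_prop
  conv_lhs => rw [← hmp.map_eq]
  rw [integral_map hmp.measurable.aemeasurable hcont.aestronglyMeasurable]
  congr 1
  funext θ
  rw [Fin.prod_univ_castSucc, nodeFrequency_partialSums_last]
  simp only [nodeFrequency_partialSums_castSucc]
  rw [fourierWeight, mul_comm (∏ i, fourierHat V (θ i))]
  congr 1
  rw [hg, ← Finset.sum_neg_distrib, Real.exp_sum, Complex.ofReal_prod]
  simp only [neg_mul]

/-! ### Decay of the Fourier weight -/

open FourierTransform in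
/-- `fourierHat V ξ` is Mathlib's Fourier transform of the Schwartz function `V` at `ξ / 2π`. -/
lemma fourierHat_decay (V : SchwartzMap (E d) ℝ) (M : ℕ) :
    ∃ K : ℝ, ∀ ξ : E d, (1 + ‖ξ‖) ^ M * ‖fourierHat V ξ‖ ≤ K := by
  set Vc : SchwartzMap (E d) ℂ := SchwartzMap.postcompCLM (𝕜 := ℝ) Complex.ofRealCLM V with hVc
  set F : SchwartzMap (E d) ℂ := 𝓕 Vc with hF
  have hhat : ∀ ξ : E d, fourierHat V ξ = F ((2 * Real.pi)⁻¹ • ξ) := by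
    intro ξ
    rw [hF, SchwartzMap.fourier_coe, Real.fourier_eq', fourierHat]
    congr 1
    funext x
    rw [smul_eq_mul, inner_smul_right]
    congr 1
    congr 1
    have : (-2 * Real.pi * ((2 * Real.pi)⁻¹ * inner ℝ x ξ)) = -inner ℝ x ξ := by
      field_simp
    rw [this]
    push_cast
    ring
  set K := 2 ^ M * ((Finset.Iic (M, 0)).sup fun m => SchwartzMap.seminorm ℝ m.1 m.2) F with hK
  refine ⟨(2 * Real.pi) ^ M * K, fun ξ => ?_⟩
  have h1 := SchwartzMap.one_add_le_sup_seminorm_apply (𝕜 := ℝ) (m := (M, 0)) (k := M) (n := 0)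
    le_rfl le_rfl F ((2 * Real.pi)⁻¹ • ξ)
  rw [norm_iteratedFDeriv_zero, ← hhat] at h1
  have hpi : 1 ≤ 2 * Real.pi := by linarith [Real.pi_gt_three]
  have h2 : 1 + ‖ξ‖ ≤ (2 * Real.pi) * (1 + ‖(2 * Real.pi)⁻¹ • ξ‖) := by
    rw [norm_smul, Real.norm_of_nonneg (by positivity), mul_add,
      mul_inv_cancel_left₀ (by positivity)]
    linarith
  calc (1 + ‖ξ‖) ^ M * ‖fourierHat V ξ‖
      ≤ ((2 * Real.pi) * (1 + ‖(2 * Real.pi)⁻¹ • ξ‖)) ^ M * ‖fourierHat V ξ‖ := by gcongr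
    _ = (2 * Real.pi) ^ M * ((1 + ‖(2 * Real.pi)⁻¹ • ξ‖) ^ M * ‖fourierHat V ξ‖) := by
        rw [mul_pow, mul_assoc]
    _ ≤ _ := by gcongr

lemma integrable_fourierHat_mul_pow (V : SchwartzMap (E d) ℝ) (M : ℕ) :
    Integrable (fun ξ : E d => ‖fourierHat V ξ‖ * (1 + ‖ξ‖) ^ M) := by
  -- `d + 1` further powers of decay make the bound integrable over `ℝ^d`
  obtain ⟨K, hK⟩ := fourierHat_decay V (M + (d + 1))
  have hc := continuous_fourierHat (V.integrable (μ := volume))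
  have h1 : Integrable (fun ξ : E d => (1 + ‖ξ‖) ^ (-((d : ℝ) + 1))) := by
    refine integrable_one_add_norm ?_
    rw [finrank_euclideanSpace, Fintype.card_fin]
    linarith
  refine (h1.const_mul K).mono' (Continuous.aestronglyMeasurable (by fun_prop))
    (ae_of_all _ fun ξ => ?_)
  rw [Real.norm_of_nonneg (by positivity), Real.rpow_neg (by positivity), ← div_eq_mul_inv,
    le_div_iff₀ (by positivity)]
  have : (1 + ‖ξ‖) ^ ((d : ℝ) + 1) = (1 + ‖ξ‖) ^ (d + 1) := by
    rw [← Real.rpow_natCast]; push_cast; rfl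
  rw [this]
  refine le_trans (le_of_eq ?_) (hK ξ)
  rw [pow_add]; ring

lemma continuous_fourierWeight (V : SchwartzMap (E d) ℝ) (m : ℕ) :
    Continuous (fourierWeight (m := m) V) := by
  have hc := continuous_fourierHat (V.integrable (μ := volume))
  unfold fourierWeight
  fun_prop

/-- The Fourier weight decays faster than any power of `∏_j (1 + |θ_j|)`. -/
lemma integrable_fourierWeight_mul_pow (V : SchwartzMap (E d) ℝ) (m M : ℕ) :
    Integrable (fun θ : Fin m → E d => ‖fourierWeight V θ‖ * (∏ j, (1 + ‖θ j‖)) ^ M) := by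
  obtain ⟨K, hK⟩ := fourierHat_decay V 0
  simp only [pow_zero, one_mul] at hK
  have hc := continuous_fourierWeight V m
  have h1 : Integrable (fun θ : Fin m → E d => ∏ j, (‖fourierHat V (θ j)‖ * (1 + ‖θ j‖) ^ M)) :=
    Integrable.fintype_prod (f := fun _ ξ => ‖fourierHat V ξ‖ * (1 + ‖ξ‖) ^ M)
      (fun _ => integrable_fourierHat_mul_pow V M)
  refine (h1.const_mul K).mono' (Continuous.aestronglyMeasurable (by fun_prop))
    (ae_of_all _ fun θ => ?_)
  have hR : 0 ≤ (∏ j, (1 + ‖θ j‖)) ^ M :=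
    pow_nonneg (Finset.prod_nonneg fun j _ => by positivity) _
  rw [Real.norm_of_nonneg (mul_nonneg (norm_nonneg _) hR), fourierWeight, norm_mul, norm_prod,
    Finset.prod_mul_distrib, Finset.prod_pow, mul_assoc]
  exact mul_le_mul_of_nonneg_right (hK _)
    (mul_nonneg (Finset.prod_nonneg fun _ _ => norm_nonneg _) hR)

lemma one_add_sum_le_prod_one_add {ι : Type*} (s : Finset ι) {f : ι → ℝ} (hf : ∀ i, 0 ≤ f i) :
    1 + ∑ i ∈ s, f i ≤ ∏ i ∈ s, (1 + f i) := by
  classical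
  induction s using Finset.induction_on with
  | empty => simp
  | insert a s ha ih =>
    rw [Finset.sum_insert ha, Finset.prod_insert ha]
    have h1 := hf a
    have h2 : 0 ≤ ∑ i ∈ s, f i := Finset.sum_nonneg fun i _ => hf i
    nlinarith

lemma one_le_prod_one_add_norm {m : ℕ} (θ : Fin m → E d) : 1 ≤ ∏ j, (1 + ‖θ j‖) :=
  Finset.one_le_prod fun j _ => by linarith [norm_nonneg (θ j)]

lemma norm_partialSums_rpow_le {α : ℝ} (hα : 0 < α) (hα₂ : α ≤ 2) {m : ℕ} (θ : Fin m → E d)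
    (i : Fin m) : ‖partialSums θ i‖ ^ α ≤ (∏ j, (1 + ‖θ j‖)) ^ 2 := by
  have h1 : ‖partialSums θ i‖ ≤ ∏ j, (1 + ‖θ j‖) := by
    calc ‖partialSums θ i‖ ≤ ∑ j ∈ Finset.Iic i, ‖θ j‖ := norm_sum_le _ _
      _ ≤ ∑ j, ‖θ j‖ := Finset.sum_le_sum_of_subset_of_nonneg (Finset.subset_univ _)
          (fun _ _ _ => norm_nonneg _)
      _ ≤ 1 + ∑ j, ‖θ j‖ := by linarith
      _ ≤ ∏ j, (1 + ‖θ j‖) := one_add_sum_le_prod_one_add _ (fun j => norm_nonneg _)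
  calc ‖partialSums θ i‖ ^ α ≤ (∏ j, (1 + ‖θ j‖)) ^ α :=
        Real.rpow_le_rpow (norm_nonneg _) h1 hα.le
    _ ≤ (∏ j, (1 + ‖θ j‖)) ^ (2 : ℝ) :=
        Real.rpow_le_rpow_of_exponent_le (one_le_prod_one_add_norm θ) hα₂
    _ = _ := Real.rpow_two _

lemma fourierIntegrand_eq {α : ℝ} (V : E d → ℝ) {m : ℕ} (ℓ : Fin m → ℕ) (θ : Fin m → E d) :
    fourierIntegrand α V ℓ θ =
      fourierWeight V θ * ((∏ i, (‖partialSums θ i‖ ^ α) ^ ℓ i : ℝ) : ℂ) := by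
  rw [fourierIntegrand, fourierWeight, Finset.prod_mul_distrib, mul_assoc, Complex.ofReal_prod]
  congr 2
  refine Finset.prod_congr rfl fun i _ => ?_
  rw [partialSums, Real.rpow_mul (norm_nonneg _), Real.rpow_natCast]

lemma integrable_fourierIntegrand {α : ℝ} (hα : 0 < α) (hα₂ : α ≤ 2) (V : SchwartzMap (E d) ℝ)
    {m : ℕ} (ℓ : Fin m → ℕ) : Integrable (fun θ : Fin m → E d => fourierIntegrand α V ℓ θ) := by
  simp only [fourierIntegrand_eq]
  have hp := continuous_partialSums (d := d) m
  have hr := continuous_norm_rpow (d := d) hα.le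
  have hW := continuous_fourierWeight V m
  have hcont : Continuous (fun θ : Fin m → E d => ∏ i, (‖partialSums θ i‖ ^ α) ^ ℓ i) :=
    continuous_finsetProd _ fun i _ => (hr.comp ((continuous_apply i).comp hp)).pow _
  refine (integrable_fourierWeight_mul_pow V m (2 * ∑ i, ℓ i)).mono'
    (hW.mul (Complex.continuous_ofReal.comp hcont)).aestronglyMeasurable (ae_of_all _ fun θ => ?_)
  rw [norm_mul, Complex.norm_real]
  refine mul_le_mul_of_nonneg_left ?_ (norm_nonneg _)
  have h0 : ∀ i, 0 ≤ (‖partialSums θ i‖ ^ α) ^ ℓ i := fun i => by positivity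
  rw [Real.norm_of_nonneg (Finset.prod_nonneg fun i _ => h0 i), pow_mul,
    ← Finset.prod_pow_eq_pow_sum]
  refine Finset.prod_le_prod (fun i _ => h0 i) fun i _ => ?_
  exact pow_le_pow_left₀ (by positivity) (norm_partialSums_rpow_le hα hα₂ θ i) _

/-! ### Expansion in small time -/

/-- The exponent `∑_i (λ_i - λ_{i+1}) |θ_1 + ⋯ + θ_i|^α`. -/
def chainExponent (α : ℝ) {m : ℕ} (l : Fin (m + 1) → ℝ) (θ : Fin m → E d) : ℝ :=
  ∑ i : Fin m, (l i.castSucc - l i.succ) * ‖partialSums θ i‖ ^ α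

lemma timeSimplex_sub_mem {m : ℕ} {l : Fin (m + 1) → ℝ} (hl : l ∈ timeSimplex (m + 1))
    (i : Fin m) : 0 < l i.castSucc - l i.succ ∧ l i.castSucc - l i.succ ≤ 1 := by
  have h1 := hl.1 i.castSucc_lt_succ
  have h2 := (hl.2 i.castSucc).2
  have h3 := (hl.2 i.succ).1
  constructor <;> linarith

lemma chainExponent_nonneg {α : ℝ} {m : ℕ} {l : Fin (m + 1) → ℝ} (hl : l ∈ timeSimplex (m + 1))
    (θ : Fin m → E d) : 0 ≤ chainExponent α l θ :=
  Finset.sum_nonneg fun i _ => mul_nonneg (timeSimplex_sub_mem hl i).1.le (by positivity)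

lemma chainExponent_le {α : ℝ} (hα : 0 < α) (hα₂ : α ≤ 2) {m : ℕ} {l : Fin (m + 1) → ℝ}
    (hl : l ∈ timeSimplex (m + 1)) (θ : Fin m → E d) :
    chainExponent α l θ ≤ m * (∏ j, (1 + ‖θ j‖)) ^ 2 := by
  calc chainExponent α l θ ≤ ∑ _i : Fin m, (∏ j, (1 + ‖θ j‖)) ^ 2 := by
        refine Finset.sum_le_sum fun i _ => ?_
        refine (mul_le_of_le_one_left (by positivity) (timeSimplex_sub_mem hl i).2).trans ?_
        exact norm_partialSums_rpow_le hα hα₂ θ i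
    _ = _ := by simp

lemma continuous_chainExponent {α : ℝ} (hα : 0 < α) (m : ℕ) :
    Continuous (fun p : (Fin (m + 1) → ℝ) × (Fin m → E d) => chainExponent α p.1 p.2) := by
  have hp := continuous_partialSums (d := d) m
  have hr := continuous_norm_rpow (d := d) hα.le
  unfold chainExponent
  refine continuous_finsetSum _ fun i _ => Continuous.mul (by fun_prop) ?_
  exact hr.comp ((continuous_apply i).comp (hp.comp continuous_snd))

/-- The sum over `ℓ` in `C_{n,k}` is the multinomial expansion of the `n`-th power of the
exponent. -/
lemma coeffNK_eq {α : ℝ} (hα : 0 < α) (hα₂ : α ≤ 2) (V : SchwartzMap (E d) ℝ) (n m : ℕ) :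
    coeffNK α V n (m + 1) = ((((2 * Real.pi) ^ (d * m))⁻¹ : ℝ) : ℂ) *
      ∫ l in timeSimplex (m + 1), ∫ θ : Fin m → E d,
        fourierWeight V θ * ((chainExponent α l θ ^ n : ℝ) : ℂ) := by
  have hinner : ∀ l : Fin (m + 1) → ℝ, ∫ θ : Fin m → E d,
      fourierWeight V θ * ((chainExponent α l θ ^ n : ℝ) : ℂ) =
      ∑ ℓ ∈ Finset.piAntidiag (Finset.univ : Finset (Fin m)) n,
        ((∏ i : Fin m, (l i.castSucc - l i.succ) ^ ℓ i : ℝ) : ℂ) *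
        ((Nat.multinomial Finset.univ ℓ : ℂ) * ∫ θ : Fin m → E d, fourierIntegrand α V ℓ θ) := by
    intro l
    simp only [← integral_const_mul]
    rw [← integral_finsetSum _ fun ℓ _ =>
      ((integrable_fourierIntegrand hα hα₂ V ℓ).const_mul _).const_mul _]
    congr 1
    funext θ
    rw [chainExponent, Finset.sum_pow_eq_sum_piAntidiag, Complex.ofReal_sum, Finset.mul_sum]
    refine Finset.sum_congr rfl fun ℓ _ => ?_
    rw [fourierIntegrand_eq]
    simp only [mul_pow, Finset.prod_mul_distrib]
    push_cast
    ring
  have hbd : ∀ ℓ : Fin m → ℕ, Integrable (fun l : Fin (m + 1) → ℝ =>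
      ((∏ i : Fin m, (l i.castSucc - l i.succ) ^ ℓ i : ℝ) : ℂ))
      (volume.restrict (timeSimplex (m + 1))) := by
    intro ℓ
    have h1 : Integrable (fun l : Fin (m + 1) → ℝ => ∏ i : Fin m, (l i.castSucc - l i.succ) ^ ℓ i)
        (volume.restrict (timeSimplex (m + 1))) := by
      refine Integrable.of_bound (C := 1) (Continuous.aestronglyMeasurable (by fun_prop)) ?_
      filter_upwards [ae_restrict_mem (measurableSet_timeSimplex _)] with l hl
      rw [norm_prod]
      refine Finset.prod_le_one (fun i _ => norm_nonneg _) fun i _ => ?_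
      rw [norm_pow, Real.norm_of_nonneg (timeSimplex_sub_mem hl i).1.le]
      exact pow_le_one₀ (timeSimplex_sub_mem hl i).1.le (timeSimplex_sub_mem hl i).2
    exact h1.ofReal
  simp only [hinner]
  rw [integral_finsetSum _ fun ℓ _ => (hbd ℓ).mul_const _, Finset.mul_sum]
  change ∑ ℓ ∈ Finset.piAntidiag (Finset.univ : Finset (Fin m)) n, (simplexWeight ℓ : ℂ) *
      ((((2 * Real.pi) ^ (d * m))⁻¹ : ℝ) : ℂ) *
        ∫ θ : Fin m → E d, fourierIntegrand α V ℓ θ = _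
  refine Finset.sum_congr rfl fun ℓ _ => ?_
  rw [integral_mul_const, integral_complex_ofReal, simplexWeight]
  push_cast
  ring

/-- For `u ≥ 0` the Taylor remainder of `exp (-u)` is bounded by a power of `u`, without an
exponential factor. -/
lemma abs_exp_neg_sub_sum_le {u : ℝ} (hu : 0 ≤ u) (M : ℕ) :
    |Real.exp (-u) - ∑ n ∈ Finset.range M, (-u) ^ n / (n.factorial : ℝ)| ≤ (M + 3) * u ^ M := by
  rcases le_total u 1 with h1 | h1
  · have h := Complex.norm_exp_sub_sum_le_norm_mul_exp ((-u : ℝ) : ℂ) M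
    have hcast : Complex.exp ((-u : ℝ) : ℂ) - ∑ n ∈ Finset.range M,
        ((-u : ℝ) : ℂ) ^ n / (n.factorial : ℂ) =
        ((Real.exp (-u) - ∑ n ∈ Finset.range M, (-u) ^ n / (n.factorial : ℝ) : ℝ) : ℂ) := by
      push_cast; rfl
    rw [hcast, Complex.norm_real, Complex.norm_real, norm_neg, Real.norm_of_nonneg hu,
      Real.norm_eq_abs] at h
    have he : Real.exp u ≤ 3 :=
      (Real.exp_le_exp.2 h1).trans (by linarith [Real.exp_one_lt_d9])
    have hp : 0 ≤ u ^ M := pow_nonneg hu _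
    have hM : (0 : ℝ) ≤ M := Nat.cast_nonneg _
    nlinarith
  · have hp : 1 ≤ u ^ M := one_le_pow₀ h1
    have he : |Real.exp (-u)| ≤ u ^ M := by
      rw [Real.abs_exp]
      exact (Real.exp_le_one_iff.2 (by linarith)).trans hp
    have hs : |∑ n ∈ Finset.range M, (-u) ^ n / (n.factorial : ℝ)| ≤ M * u ^ M := by
      calc |∑ n ∈ Finset.range M, (-u) ^ n / (n.factorial : ℝ)|
          ≤ ∑ n ∈ Finset.range M, |(-u) ^ n / (n.factorial : ℝ)| := Finset.abs_sum_le_sum_abs _ _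
        _ ≤ ∑ _n ∈ Finset.range M, u ^ M := by
            refine Finset.sum_le_sum fun n hn => ?_
            rw [abs_div, abs_pow, abs_neg, abs_of_nonneg hu, Nat.abs_cast]
            refine (div_le_self (by positivity) ?_).trans
              (pow_le_pow_right₀ h1 (Finset.mem_range.1 hn).le)
            exact_mod_cast Nat.one_le_iff_ne_zero.2 (Nat.factorial_ne_zero n)
        _ = _ := by simp
    refine (abs_sub _ _).trans ?_
    nlinarith

/-- Taylor expansion in `t` of the Fourier representation, integrated over the simplex. -/
lemma exists_expansion_bound {α : ℝ} (hα : 0 < α) (hα₂ : α ≤ 2) (V : SchwartzMap (E d) ℝ)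
    (m M : ℕ) : ∃ K : ℝ, ∀ t : ℝ, 0 < t →
      ‖((((2 * Real.pi) ^ (d * m))⁻¹ : ℝ) : ℂ) * (∫ l in timeSimplex (m + 1),
          ∫ θ : Fin m → E d, fourierWeight V θ * ((Real.exp (-(t * chainExponent α l θ)) : ℝ) : ℂ))
        - ∑ n ∈ Finset.range M, (-(t : ℂ)) ^ n / (n.factorial : ℂ) * coeffNK α V n (m + 1)‖
      ≤ K * t ^ M := by
  set κ : ℂ := ((((2 * Real.pi) ^ (d * m))⁻¹ : ℝ) : ℂ) with hκ
  set μ := ((volume : Measure (Fin (m + 1) → ℝ)).restrict (timeSimplex (m + 1))).prod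
    (volume : Measure (Fin m → E d)) with hμ
  have hmem : ∀ᵐ p ∂μ, p.1 ∈ timeSimplex (m + 1) :=
    Measure.quasiMeasurePreserving_fst.ae (ae_restrict_mem (measurableSet_timeSimplex _))
  have hdom : ∀ M' : ℕ, Integrable (fun p : (Fin (m + 1) → ℝ) × (Fin m → E d) =>
      ‖fourierWeight V p.2‖ * (∏ j, (1 + ‖p.2 j‖)) ^ M') μ := fun M' =>
    (integrable_fourierWeight_mul_pow V m M').comp_snd _
  have hW : Continuous (fun p : (Fin (m + 1) → ℝ) × (Fin m → E d) => fourierWeight V p.2) :=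
    (continuous_fourierWeight V m).comp continuous_snd
  have hu := continuous_chainExponent (d := d) hα m
  have hpow : ∀ n : ℕ, Integrable (fun p : (Fin (m + 1) → ℝ) × (Fin m → E d) =>
      fourierWeight V p.2 * ((chainExponent α p.1 p.2 ^ n : ℝ) : ℂ)) μ := by
    intro n
    refine ((hdom (2 * n)).const_mul ((m : ℝ) ^ n)).mono'
      (Continuous.aestronglyMeasurable (by fun_prop)) ?_
    filter_upwards [hmem] with p hp
    have h0 := chainExponent_nonneg (α := α) hp p.2
    rw [norm_mul, Complex.norm_real, Real.norm_of_nonneg (pow_nonneg h0 n), mul_left_comm]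
    refine mul_le_mul_of_nonneg_left ?_ (norm_nonneg _)
    rw [pow_mul, ← mul_pow]
    exact pow_le_pow_left₀ h0 (chainExponent_le hα hα₂ hp p.2) n
  have hexp : ∀ t : ℝ, 0 < t → Integrable (fun p : (Fin (m + 1) → ℝ) × (Fin m → E d) =>
      fourierWeight V p.2 * ((Real.exp (-(t * chainExponent α p.1 p.2)) : ℝ) : ℂ)) μ := by
    intro t ht
    refine (hdom 0).mono' (Continuous.aestronglyMeasurable (by fun_prop)) ?_
    filter_upwards [hmem] with p hp
    have h0 := chainExponent_nonneg (α := α) hp p.2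
    rw [norm_mul, Complex.norm_real, Real.norm_eq_abs, Real.abs_exp]
    refine mul_le_mul_of_nonneg_left ?_ (norm_nonneg _)
    rw [pow_zero]
    exact Real.exp_le_one_iff.2 (by have := mul_nonneg ht.le h0; linarith)
  refine ⟨‖κ‖ * ∫ p, (M + 3) * (‖fourierWeight V p.2‖ * chainExponent α p.1 p.2 ^ M) ∂μ,
    fun t ht => ?_⟩
  have hco : ∀ n, coeffNK α V n (m + 1) = κ * ∫ p : (Fin (m + 1) → ℝ) × (Fin m → E d),
      fourierWeight V p.2 * ((chainExponent α p.1 p.2 ^ n : ℝ) : ℂ) ∂μ := by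
    intro n
    rw [coeffNK_eq hα hα₂, hμ, integral_prod _ (hpow n)]
  have hdiff : κ * (∫ l in timeSimplex (m + 1),
          ∫ θ : Fin m → E d, fourierWeight V θ * ((Real.exp (-(t * chainExponent α l θ)) : ℝ) : ℂ))
        - ∑ n ∈ Finset.range M, (-(t : ℂ)) ^ n / (n.factorial : ℂ) * coeffNK α V n (m + 1) =
      κ * ∫ p : (Fin (m + 1) → ℝ) × (Fin m → E d), fourierWeight V p.2 *
        ((Real.exp (-(t * chainExponent α p.1 p.2)) - ∑ n ∈ Finset.range M,
          (-(t * chainExponent α p.1 p.2)) ^ n / (n.factorial : ℝ) : ℝ) : ℂ) ∂μ := by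
    have h1 : ∀ p : (Fin (m + 1) → ℝ) × (Fin m → E d), fourierWeight V p.2 *
        ((Real.exp (-(t * chainExponent α p.1 p.2)) - ∑ n ∈ Finset.range M,
          (-(t * chainExponent α p.1 p.2)) ^ n / (n.factorial : ℝ) : ℝ) : ℂ) =
        fourierWeight V p.2 * ((Real.exp (-(t * chainExponent α p.1 p.2)) : ℝ) : ℂ) -
        ∑ n ∈ Finset.range M, (-(t : ℂ)) ^ n / (n.factorial : ℂ) *
          (fourierWeight V p.2 * ((chainExponent α p.1 p.2 ^ n : ℝ) : ℂ)) := by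
      intro p
      rw [Complex.ofReal_sub, mul_sub, Complex.ofReal_sum, Finset.mul_sum]
      congr 1
      refine Finset.sum_congr rfl fun n _ => ?_
      rw [← neg_mul, mul_pow]
      push_cast
      ring
    simp only [h1]
    rw [integral_sub (hexp t ht) (integrable_finsetSum _ fun n _ => (hpow n).const_mul _),
      integral_finsetSum _ fun n _ => (hpow n).const_mul _, mul_sub, Finset.mul_sum]
    congr 1
    · rw [hμ, integral_prod _ (hexp t ht)]
    · refine Finset.sum_congr rfl fun n _ => ?_
      rw [integral_const_mul, hco]
      ring
  rw [hdiff, norm_mul, mul_assoc]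
  refine mul_le_mul_of_nonneg_left ?_ (norm_nonneg _)
  rw [← integral_mul_const]
  refine norm_integral_le_of_norm_le ?_ ?_
  · refine Integrable.mul_const ?_ _
    refine Integrable.const_mul ?_ _
    refine (hpow M).norm.congr ?_
    filter_upwards [hmem] with p hp
    rw [norm_mul, Complex.norm_real,
      Real.norm_of_nonneg (pow_nonneg (chainExponent_nonneg (α := α) hp p.2) M)]
  · filter_upwards [hmem] with p hp
    have h0 := chainExponent_nonneg (α := α) hp p.2
    rw [norm_mul, Complex.norm_real, Real.norm_eq_abs]
    calc _ ≤ ‖fourierWeight V p.2‖ * ((M + 3) * (t * chainExponent α p.1 p.2) ^ M) :=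
          mul_le_mul_of_nonneg_left (abs_exp_neg_sub_sum_le (mul_nonneg ht.le h0) M)
            (norm_nonneg _)
      _ = _ := by rw [mul_pow]; ring

/-! ### The heat content -/

section Expansion

variable {Ω : Type*} [MeasurableSpace Ω] {α t : ℝ} {X : ℝ → Ω → E d} {P : E d → E d → Measure Ω}
  {V : E d → ℝ} {C : ℝ}

/-- The chain integral `∫_{I_{m+1}} ∫ ∏ V(z_i) ∏ p_{t(λ_i - λ_{i+1})}(z_i, z_{i+1}) dz dλ`. -/
def chainIntegral (α : ℝ) (V : E d → ℝ) (m : ℕ) (t : ℝ) : ℝ :=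
  ∫ l in timeSimplex (m + 1), ∫ z : Fin (m + 1) → E d, (∏ i, V (z i)) * chainDensity α t l z

lemma chainIntegral_zero (α : ℝ) (V : E d → ℝ) (t : ℝ) : chainIntegral α V 0 t = ∫ x, V x := by
  have h1 : ∫ _l in timeSimplex 1, (1 : ℝ) = 1 := by
    have h := pow_integral_eq_factorial_mul_integral_timeSimplex 1 (fun _ => (1 : ℝ))
      (integrableOn_const (by simp))
    simpa using h.symm
  have h2 : ∫ z : Fin 1 → E d, V (z 0) = ∫ x, V x :=
    (volume_preserving_funUnique (Fin 1) (E d)).integral_comp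
      (MeasurableEquiv.measurableEmbedding _) V
  have h3 : chainIntegral α V 0 t =
      ∫ _l in timeSimplex 1, (1 : ℝ) * ∫ z : Fin 1 → E d, V (z 0) := by
    simp [chainIntegral, chainDensity]
  rw [h3, integral_mul_const, h1, one_mul, h2]

lemma chainIntegral_eq_fourier (hd : 1 ≤ d) (hα : 0 < α) (hVi : Integrable V) (ht : 0 < t)
    (m : ℕ) : (chainIntegral α V m t : ℂ) = ((((2 * Real.pi) ^ (d * m))⁻¹ : ℝ) : ℂ) *
      ∫ l in timeSimplex (m + 1), ∫ θ : Fin m → E d,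
        fourierWeight V θ * ((Real.exp (-(t * chainExponent α l θ)) : ℝ) : ℂ) := by
  rw [chainIntegral, ← integral_complex_ofReal, ← integral_const_mul]
  refine setIntegral_congr_fun (measurableSet_timeSimplex _) fun l hl => ?_
  have h := integral_chain_eq_fourier hd hα hVi (fun i : Fin m => t * (l i.castSucc - l i.succ))
    (fun i => mul_pos ht (timeSimplex_sub_mem hl i).1)
  refine Eq.trans h ?_
  simp only [chainExponent, Finset.mul_sum, mul_assoc]

/-- The Feynman–Kac kernel after rescaling the time interval `[0, t]` to `[0, 1]`. -/
lemma schrodingerKernel_eq (P : ℝ → E d → E d → Measure Ω) (x y : E d) :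
    schrodingerKernel α V X P t x y =
      stableKernel α t x y * ∫ ω, Real.exp (-(t * pathMean V X t ω)) ∂(P t x y) := by
  rw [schrodingerKernel]
  congr 2
  funext ω
  have h := intervalIntegral.mul_integral_comp_mul_left (a := 0) (b := 1)
    (f := fun s => V (X s ω)) t
  rw [mul_zero, mul_one] at h
  rw [← h, pathMean, intervalIntegral.integral_of_le zero_le_one, integral_Ioc_eq_integral_Ioo]

lemma IsStableBridge.integrable_pathMean_comp {P : Measure Ω} {x y : E d}
    (h : IsStableBridge α t x y X P) (ht : 0 < t) (hV : Continuous V) (hC : ∀ z, |V z| ≤ C)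
    {f : ℝ → ℝ} (hf : Continuous f) : Integrable (fun ω => f (pathMean V X t ω)) P := by
  have := h.isProbabilityMeasure
  obtain ⟨K, hK⟩ := (isCompact_Icc (a := -C) (b := C)).exists_bound_of_continuousOn hf.continuousOn
  refine Integrable.of_bound (C := K)
    (hf.comp_aestronglyMeasurable (h.aestronglyMeasurable_pathMean ht hV hC))
    (ae_of_all _ fun ω => hK _ (abs_le.1 (abs_pathMean_le hC ω)))

/-- The difference of the perturbed and the free heat kernel. -/
def kernelDifference (α : ℝ) (V : E d → ℝ) (X : ℝ → Ω → E d) (P : E d → E d → Measure Ω) (t : ℝ)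
    (q : E d × E d) : ℝ :=
  stableKernel α t q.1 q.2 * ∫ ω, Real.exp (-(t * pathMean V X t ω)) ∂(P q.1 q.2) -
    stableKernel α t q.1 q.2

/-- The remainder of the moment expansion is the bridge mean of the remainder of the exponential
series. -/
lemma kernelDifference_sub_sum_eq (ht : 0 < t) (hP : ∀ x y, IsStableBridge α t x y X (P x y))
    (hV : Continuous V) (hC : ∀ z, |V z| ≤ C) (N : ℕ) (q : E d × E d) :
    kernelDifference α V X P t q - ∑ k ∈ Finset.range N,
      (-t) ^ (k + 1) / ((k + 1).factorial : ℝ) * weightedMoment α V X P t (k + 1) q =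
    stableKernel α t q.1 q.2 * ∫ ω, (Real.exp (-(t * pathMean V X t ω)) -
      ∑ k ∈ Finset.range (N + 1), (-(t * pathMean V X t ω)) ^ k / (k.factorial : ℝ))
        ∂(P q.1 q.2) := by
  have hb := hP q.1 q.2
  have := hb.isProbabilityMeasure
  have hk : ∀ k : ℕ, Integrable (fun ω => (-(t * pathMean V X t ω)) ^ k / (k.factorial : ℝ))
      (P q.1 q.2) := fun k =>
    hb.integrable_pathMean_comp ht hV hC (f := fun r => (-(t * r)) ^ k / (k.factorial : ℝ))
      (by fun_prop)
  have he : Integrable (fun ω => Real.exp (-(t * pathMean V X t ω))) (P q.1 q.2) :=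
    hb.integrable_pathMean_comp ht hV hC (f := fun r => Real.exp (-(t * r))) (by fun_prop)
  rw [integral_sub he (integrable_finsetSum _ fun k _ => hk k),
    integral_finsetSum _ fun k _ => hk k, Finset.sum_range_succ', mul_sub, mul_add,
    Finset.mul_sum, kernelDifference]
  have h0 : ∫ ω, (-(t * pathMean V X t ω)) ^ 0 / (Nat.factorial 0 : ℝ) ∂(P q.1 q.2) = 1 := by
    simp
  rw [h0]
  have hs : ∀ k : ℕ, stableKernel α t q.1 q.2 *
      ∫ ω, (-(t * pathMean V X t ω)) ^ (k + 1) / ((k + 1).factorial : ℝ) ∂(P q.1 q.2) =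
      (-t) ^ (k + 1) / ((k + 1).factorial : ℝ) * weightedMoment α V X P t (k + 1) q := by
    intro k
    rw [weightedMoment, mul_left_comm ((-t) ^ (k + 1) / ((k + 1).factorial : ℝ)),
      ← integral_const_mul ((-t) ^ (k + 1) / ((k + 1).factorial : ℝ))]
    congr 1
    refine integral_congr_ae (ae_of_all _ fun ω => ?_)
    simp only
    rw [← neg_mul, mul_pow]
    ring
  simp only [hs]
  ring

/-- Of the `N + 1` factors of the path mean in the remainder, `N` are bounded by `C` and one is
kept, so that the bound is integrable in the end points. -/
lemma abs_kernelDifference_sub_sum_le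
    (hpos : ∀ t : ℝ, 0 < t → ∀ x : E d, 0 < stableDensity α t x) (ht : 0 < t)
    (hP : ∀ x y, IsStableBridge α t x y X (P x y))
    (hV : Continuous V) (hC : ∀ z, |V z| ≤ C) (N : ℕ) (q : E d × E d) :
    |kernelDifference α V X P t q - ∑ k ∈ Finset.range N,
      (-t) ^ (k + 1) / ((k + 1).factorial : ℝ) * weightedMoment α V X P t (k + 1) q| ≤
    t ^ (N + 1) * C ^ N * Real.exp (t * C) *
      weightedMoment α (fun z => |V z|) X P t 1 q := by
  have hb := hP q.1 q.2
  have hp : 0 < stableKernel α t q.1 q.2 := hpos t ht _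
  have hC0 : 0 ≤ C := (abs_nonneg _).trans (hC 0)
  have habs : Integrable (fun ω => pathMean (fun z => |V z|) X t ω) (P q.1 q.2) :=
    hb.integrable_pathMean_comp ht hV.abs (C := C) (fun z => by rw [abs_abs]; exact hC z)
      (f := fun r => r) continuous_id
  rw [kernelDifference_sub_sum_eq ht hP hV hC, abs_mul, abs_of_pos hp, weightedMoment,
    mul_left_comm]
  refine mul_le_mul_of_nonneg_left ?_ hp.le
  simp only [pow_one]
  rw [← integral_const_mul, ← Real.norm_eq_abs]
  refine norm_integral_le_of_norm_le (habs.const_mul _) (ae_of_all _ fun ω => ?_)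
  have hJ := abs_pathMean_le hC (X := X) (t := t) ω
  have hJ' : |pathMean V X t ω| ≤ pathMean (fun z => |V z|) X t ω := by
    simpa [pathMean] using norm_integral_le_integral_norm
      (μ := volume.restrict (Set.Ioo (0 : ℝ) 1)) (fun s => V (X (t * s) ω))
  have h := Complex.norm_exp_sub_sum_le_norm_mul_exp ((-(t * pathMean V X t ω) : ℝ) : ℂ) (N + 1)
  have hcast : Complex.exp ((-(t * pathMean V X t ω) : ℝ) : ℂ) - ∑ n ∈ Finset.range (N + 1),
      ((-(t * pathMean V X t ω) : ℝ) : ℂ) ^ n / (n.factorial : ℂ) =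
      ((Real.exp (-(t * pathMean V X t ω)) - ∑ n ∈ Finset.range (N + 1),
        (-(t * pathMean V X t ω)) ^ n / (n.factorial : ℝ) : ℝ) : ℂ) := by
    push_cast; rfl
  rw [hcast, Complex.norm_real, Complex.norm_real, norm_neg, norm_mul, Real.norm_of_nonneg ht.le,
    Real.norm_eq_abs (pathMean V X t ω)] at h
  refine h.trans ?_
  calc (t * |pathMean V X t ω|) ^ (N + 1) * Real.exp (t * |pathMean V X t ω|)
      = t ^ (N + 1) * |pathMean V X t ω| ^ N * Real.exp (t * |pathMean V X t ω|) *
          |pathMean V X t ω| := by rw [mul_pow, pow_succ |pathMean V X t ω|]; ring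
    _ ≤ _ := by gcongr

/-- Measurability in the end points is inherited from the moments, since the exponential series
converges boundedly. -/
lemma aestronglyMeasurable_kernelDifference (hd : 1 ≤ d) (hα : 0 < α) (ht : 0 < t)
    (hpos : ∀ t : ℝ, 0 < t → ∀ x : E d, 0 < stableDensity α t x)
    (hP : ∀ x y, IsStableBridge α t x y X (P x y))
    (hV : Continuous V) (hC : ∀ z, |V z| ≤ C) (hVi : Integrable V) :
    AEStronglyMeasurable (kernelDifference α V X P t) volume := by
  refine aestronglyMeasurable_of_tendsto_ae atTop (f := fun (n : ℕ) q => ∑ k ∈ Finset.range n,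
      (-t) ^ (k + 1) / ((k + 1).factorial : ℝ) * weightedMoment α V X P t (k + 1) q)
    (fun n => ?_) (ae_of_all _ fun q => ?_)
  · have := integrable_finsetSum (Finset.range n) fun k _ =>
      (integrable_weightedMoment hd hα ht hpos hP hV hC hVi k).1.const_mul
        ((-t) ^ (k + 1) / ((k + 1).factorial : ℝ))
    exact this.aestronglyMeasurable
  · have hb := hP q.1 q.2
    have := hb.isProbabilityMeasure
    have hC0 : 0 ≤ C := (abs_nonneg _).trans (hC 0)
    have hlim : Tendsto (fun n : ℕ => ∫ ω, (Real.exp (-(t * pathMean V X t ω)) -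
      ∑ k ∈ Finset.range (n + 1), (-(t * pathMean V X t ω)) ^ k / (k.factorial : ℝ))
        ∂(P q.1 q.2)) atTop (𝓝 (∫ _ω, (0 : ℝ) ∂(P q.1 q.2))) := by
      refine tendsto_integral_of_dominated_convergence
        (fun _ => Real.exp (t * C) + Real.exp (t * C)) (fun n => ?_) (integrable_const _)
        (fun n => ae_of_all _ fun ω => ?_) (ae_of_all _ fun ω => ?_)
      · exact (hb.integrable_pathMean_comp ht hV hC (f := fun r => Real.exp (-(t * r)) -
          ∑ k ∈ Finset.range (n + 1), (-(t * r)) ^ k / (k.factorial : ℝ))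
            (by fun_prop)).aestronglyMeasurable
      · have hJ : |-(t * pathMean V X t ω)| ≤ t * C := by
          rw [abs_neg, abs_mul, abs_of_pos ht]
          exact mul_le_mul_of_nonneg_left (abs_pathMean_le hC ω) ht.le
        refine (norm_sub_le _ _).trans (add_le_add ?_ ?_)
        · rw [Real.norm_eq_abs, Real.abs_exp]
          exact Real.exp_le_exp.2 ((le_abs_self _).trans hJ)
        · refine (norm_sum_le _ _).trans ?_
          refine le_trans ?_ (Real.exp_le_exp.2 hJ)
          refine le_trans (le_of_eq ?_) (Real.sum_le_exp_of_nonneg (abs_nonneg _) (n + 1))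
          refine Finset.sum_congr rfl fun k _ => ?_
          rw [norm_div, norm_pow, Real.norm_eq_abs, Real.norm_natCast]
      · have hs : HasSum (fun k : ℕ => (-(t * pathMean V X t ω)) ^ k / (k.factorial : ℝ))
            (Real.exp (-(t * pathMean V X t ω))) := by
          rw [Real.exp_eq_exp_ℝ]
          exact NormedSpace.expSeries_div_hasSum_exp _
        have h1 := (hs.tendsto_sum_nat.comp (tendsto_add_atTop_nat 1)).const_sub
          (Real.exp (-(t * pathMean V X t ω)))
        rw [sub_self] at h1
        exact h1
    rw [integral_zero] at hlim
    have h2 := (hlim.const_mul (stableKernel α t q.1 q.2)).const_sub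
      (kernelDifference α V X P t q)
    rw [mul_zero, sub_zero] at h2
    refine h2.congr fun n => ?_
    rw [← kernelDifference_sub_sum_eq ht hP hV hC n q, sub_sub_cancel]

lemma integrable_kernelDifference (hd : 1 ≤ d) (hα : 0 < α) (ht : 0 < t)
    (hpos : ∀ t : ℝ, 0 < t → ∀ x : E d, 0 < stableDensity α t x)
    (hP : ∀ x y, IsStableBridge α t x y X (P x y))
    (hV : Continuous V) (hC : ∀ z, |V z| ≤ C) (hVi : Integrable V) :
    Integrable (kernelDifference α V X P t) := by
  have hA := (integrable_weightedMoment hd hα ht hpos hP hV.abs (C := C)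
    (fun z => by rw [abs_abs]; exact hC z) hVi.abs 0).1
  refine (hA.const_mul (t ^ (0 + 1) * C ^ 0 * Real.exp (t * C))).mono'
    (aestronglyMeasurable_kernelDifference hd hα ht hpos hP hV hC hVi) (ae_of_all _ fun q => ?_)
  have h := abs_kernelDifference_sub_sum_le hpos ht hP hV hC 0 q
  rwa [Finset.range_zero, Finset.sum_empty, sub_zero] at h

/-- Moment expansion of the heat content with a remainder of order `t^{N+1}`. -/
lemma abs_integral_kernelDifference_sub_sum_le (hd : 1 ≤ d) (hα : 0 < α) (ht : 0 < t)
    (hpos : ∀ t : ℝ, 0 < t → ∀ x : E d, 0 < stableDensity α t x)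
    (hP : ∀ x y, IsStableBridge α t x y X (P x y))
    (hV : Continuous V) (hC : ∀ z, |V z| ≤ C) (hVi : Integrable V) (N : ℕ) :
    |(∫ q, kernelDifference α V X P t q) - ∑ k ∈ Finset.range N,
      (-t) ^ (k + 1) * chainIntegral α V k t| ≤
    t ^ (N + 1) * C ^ N * Real.exp (t * C) * ∫ x, |V x| := by
  have hw := fun k => integrable_weightedMoment hd hα ht hpos hP hV hC hVi k
  have hA := integrable_weightedMoment hd hα ht hpos hP hV.abs (C := C)
    (fun z => by rw [abs_abs]; exact hC z) hVi.abs 0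
  have hD := integrable_kernelDifference hd hα ht hpos hP hV hC hVi
  have h1 : (∫ q, kernelDifference α V X P t q) - ∑ k ∈ Finset.range N,
      (-t) ^ (k + 1) * chainIntegral α V k t =
      ∫ q, (kernelDifference α V X P t q - ∑ k ∈ Finset.range N,
        (-t) ^ (k + 1) / ((k + 1).factorial : ℝ) * weightedMoment α V X P t (k + 1) q) := by
    rw [integral_sub hD (integrable_finsetSum _ fun k _ => (hw k).1.const_mul _),
      integral_finsetSum _ fun k _ => (hw k).1.const_mul _]
    congr 1
    refine Finset.sum_congr rfl fun k _ => ?_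
    rw [integral_const_mul, (hw k).2, ← mul_assoc, div_mul_cancel₀ _
      (Nat.cast_ne_zero.2 (Nat.factorial_ne_zero _)), chainIntegral]
  have h2 : ∫ x, |V x| = ∫ q, weightedMoment α (fun z => |V z|) X P t 1 q := by
    rw [hA.2, ← chainIntegral_zero α (fun z => |V z|) t, chainIntegral]
    simp
  rw [h1, h2, ← integral_const_mul]
  refine norm_integral_le_of_norm_le (f := fun q => kernelDifference α V X P t q -
    ∑ k ∈ Finset.range N, (-t) ^ (k + 1) / ((k + 1).factorial : ℝ) *
      weightedMoment α V X P t (k + 1) q) (hA.1.const_mul _)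
    (ae_of_all _ fun q => abs_kernelDifference_sub_sum_le hpos ht hP hV hC N q)

end Expansion

/-- Regrouping the double expansion by the total power of `t`. -/
lemma sum_pow_mul_coeff_eq (α : ℝ) (V : E d → ℝ) (N : ℕ) (w : ℂ) :
    ∑ ℓ ∈ Finset.Icc 2 N, w ^ ℓ * coeff α V ℓ =
      ∑ m ∈ Finset.Ico 1 N, w ^ (m + 1) * ∑ n ∈ Finset.range (N - m),
        w ^ n / (n.factorial : ℂ) * coeffNK α V n (m + 1) := by
  simp only [coeff, Finset.mul_sum]
  rw [Finset.sum_sigma', Finset.sum_sigma']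
  refine Finset.sum_bij' (fun p _ => ⟨p.2.2 - 1, p.2.1⟩)
    (fun r _ => ⟨r.2 + (r.1 + 1), (r.2, r.1 + 1)⟩) ?_ ?_ ?_ ?_ ?_
  · rintro ⟨ℓ, n, k⟩ h
    simp only [Finset.mem_sigma, Finset.mem_Icc, Finset.mem_filter,
      Finset.HasAntidiagonal.mem_antidiagonal, Finset.mem_Ico, Finset.mem_range] at h ⊢
    omega
  · rintro ⟨m, n⟩ h
    simp only [Finset.mem_sigma, Finset.mem_Icc, Finset.mem_filter,
      Finset.HasAntidiagonal.mem_antidiagonal, Finset.mem_Ico, Finset.mem_range] at h ⊢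
    obtain ⟨⟨h1, h2⟩, h3⟩ := h
    exact ⟨⟨by omega, by omega⟩, trivial, by omega⟩
  · rintro ⟨ℓ, n, k⟩ h
    simp only [Finset.mem_sigma, Finset.mem_Icc, Finset.mem_filter,
      Finset.HasAntidiagonal.mem_antidiagonal] at h
    obtain ⟨_, rfl, hk⟩ := h
    have : k - 1 + 1 = k := by omega
    simp only [this]
  · rintro ⟨m, n⟩ _
    simp
  · rintro ⟨ℓ, n, k⟩ h
    simp only [Finset.mem_sigma, Finset.mem_Icc, Finset.mem_filter,
      Finset.HasAntidiagonal.mem_antidiagonal] at h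
    obtain ⟨_, rfl, hk⟩ := h
    have : k - 1 + 1 = k := by omega
    simp only [this]
    rw [pow_add]
    ring

end HeatContent

end

theorem mainTheorem2 {d : ℕ} (hd : 1 ≤ d) {α : ℝ} (hα₀ : 0 < α) (hα₂ : α ≤ 2)
    {Ω : Type*} [MeasurableSpace Ω]
    (X : ℝ → Ω → HeatContent.E d)
    (P : ℝ → HeatContent.E d → HeatContent.E d → Measure Ω)
    (hP : ∀ t : ℝ, 0 < t → ∀ x y : HeatContent.E d,
      HeatContent.IsStableBridge α t x y X (P t x y))
    (V : SchwartzMap (HeatContent.E d) ℝ) (N : ℕ) (hN : 2 ≤ N) :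
    (∀ t : ℝ, 0 < t → Integrable (fun z : HeatContent.E d × HeatContent.E d =>
      HeatContent.schrodingerKernel α V X P t z.1 z.2 - HeatContent.stableKernel α t z.1 z.2)) ∧
    (∀ (m : ℕ), 1 ≤ m → ∀ ℓ : Fin m → ℕ,
      Integrable (fun θ : Fin m → HeatContent.E d => HeatContent.fourierIntegrand α V ℓ θ)) ∧
    (fun t : ℝ => ((HeatContent.heatContent α V X P t : ℝ) : ℂ) -
        (-(t : ℂ) * ((∫ x, V x : ℝ) : ℂ) +
          ∑ ℓ ∈ Finset.Icc 2 N, (-(t : ℂ)) ^ ℓ * HeatContent.coeff α V ℓ))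
      =O[𝓝[>] (0 : ℝ)] (fun t : ℝ => t ^ (N + 1)) := by
  have hpos : ∀ t : ℝ, 0 < t → ∀ x : HeatContent.E d, 0 < HeatContent.stableDensity α t x := by
    intro t ht
    refine HeatContent.stableDensity_pos_of_ne_zero hd hα₀ ht fun x => ?_
    have h := (hP t ht x 0).stableKernel_ne_zero ht
    rwa [HeatContent.stableKernel, sub_zero] at h
  have hV := V.continuous
  have hVi : Integrable V := V.integrable
  obtain ⟨C, hC⟩ : ∃ C : ℝ, ∀ z, |V z| ≤ C := by
    obtain ⟨C, hC⟩ := V.decay 0 0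
    exact ⟨C, fun z => by simpa using hC.2 z⟩
  have hkd : ∀ t : ℝ, (fun z : HeatContent.E d × HeatContent.E d =>
      HeatContent.schrodingerKernel α V X P t z.1 z.2 - HeatContent.stableKernel α t z.1 z.2) =
      HeatContent.kernelDifference α V X (P t) t := by
    intro t
    funext z
    rw [HeatContent.schrodingerKernel_eq, HeatContent.kernelDifference]
  have hint : ∀ t : ℝ, 0 < t → Integrable (fun z : HeatContent.E d × HeatContent.E d =>
      HeatContent.schrodingerKernel α V X P t z.1 z.2 -
        HeatContent.stableKernel α t z.1 z.2) := by
    intro t ht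
    rw [hkd]
    exact HeatContent.integrable_kernelDifference hd hα₀ ht hpos (hP t ht) hV hC hVi
  refine ⟨hint, fun m _ ℓ => HeatContent.integrable_fourierIntegrand hα₀ hα₂ V ℓ, ?_⟩
  have hC0 : 0 ≤ C := (abs_nonneg _).trans (hC 0)
  -- the term with `k = m + 1` factors `V` carries `t^(m+1)`, hence is expanded to order `N - m`
  choose K hK using fun m => HeatContent.exists_expansion_bound (d := d) hα₀ hα₂ V m (N - m)
  refine IsBigO.of_bound (C ^ N * Real.exp C * (∫ x, |V x|) + ∑ m ∈ Finset.Ico 1 N, K m) ?_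
  have hIoo : Set.Ioo (0 : ℝ) 1 ∈ 𝓝[>] (0 : ℝ) := Ioo_mem_nhdsGT one_pos
  filter_upwards [hIoo] with t ht
  have ht0 : 0 < t := ht.1
  have hQ : HeatContent.heatContent α V X P t =
      ∫ q, HeatContent.kernelDifference α V X (P t) t q := by
    rw [← hkd, HeatContent.heatContent, Measure.volume_eq_prod]
    exact (integral_prod _ (hint t ht0)).symm
  have hrem := HeatContent.abs_integral_kernelDifference_sub_sum_le hd hα₀ ht0 hpos (hP t ht0)
    hV hC hVi N
  rw [← hQ] at hrem
  set S : ℕ → ℂ := fun m => ∑ n ∈ Finset.range (N - m),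
    (-(t : ℂ)) ^ n / (n.factorial : ℂ) * HeatContent.coeffNK α V n (m + 1) with hS
  have hterm : ∀ m ∈ Finset.Ico 1 N,
      ‖(-(t : ℂ)) ^ (m + 1) * ((HeatContent.chainIntegral α V m t : ℂ) - S m)‖ ≤
        K m * t ^ (N + 1) := by
    intro m hm
    have h := hK m t ht0
    rw [← HeatContent.chainIntegral_eq_fourier hd hα₀ hVi ht0] at h
    have hexp : m + 1 + (N - m) = N + 1 := by
      have := (Finset.mem_Ico.1 hm).2
      omega
    rw [norm_mul, norm_pow, norm_neg, Complex.norm_real, Real.norm_of_nonneg ht0.le, ← hexp,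
      pow_add t (m + 1), mul_left_comm]
    exact mul_le_mul_of_nonneg_left h (by positivity)
  have hsplit : ((HeatContent.heatContent α V X P t : ℝ) : ℂ) -
        (-(t : ℂ) * ((∫ x, V x : ℝ) : ℂ) +
          ∑ ℓ ∈ Finset.Icc 2 N, (-(t : ℂ)) ^ ℓ * HeatContent.coeff α V ℓ) =
      ((HeatContent.heatContent α V X P t - ∑ k ∈ Finset.range N,
        (-t) ^ (k + 1) * HeatContent.chainIntegral α V k t : ℝ) : ℂ) +
      ∑ m ∈ Finset.Ico 1 N,
        (-(t : ℂ)) ^ (m + 1) * ((HeatContent.chainIntegral α V m t : ℂ) - S m) := by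
    rw [HeatContent.sum_pow_mul_coeff_eq, Finset.range_eq_Ico,
      Finset.sum_eq_sum_Ico_succ_bot (by omega : 0 < N), HeatContent.chainIntegral_zero]
    simp only [mul_sub, Finset.sum_sub_distrib, hS]
    push_cast
    ring
  rw [hsplit]
  refine (norm_add_le _ _).trans ?_
  rw [Real.norm_of_nonneg (pow_nonneg ht0.le _), add_mul]
  refine add_le_add ?_ ?_
  · rw [Complex.norm_real, Real.norm_eq_abs]
    refine hrem.trans ?_
    have hexp : Real.exp (t * C) ≤ Real.exp C :=
      Real.exp_le_exp.2 (mul_le_of_le_one_left hC0 ht.2.le)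
    have hVnn : 0 ≤ ∫ x, |V x| := integral_nonneg fun _ => abs_nonneg _
    calc t ^ (N + 1) * C ^ N * Real.exp (t * C) * ∫ x, |V x|
        ≤ t ^ (N + 1) * C ^ N * Real.exp C * ∫ x, |V x| := by gcongr
      _ = _ := by ring
  · rw [Finset.sum_mul]
    exact (norm_sum_le _ _).trans (Finset.sum_le_sum hterm)
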